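/- **Setting.** Let $K\in\mathbb N$, let $\mathcal R\subset[0,K]$ be a closed set containing $0$ and $K$, and let $G:[0,K]\to\mathbb R$ be Lipschitz and linearly interpolated off $\mathcal R$, that is, affine on $[a,b]$ for every bounded component $(a,b)$ of $\mathbb R\setminus\mathcal R$. A Borel function $u:\mathbb R\times(0,\infty)\to[0,K]$ is an *entropy solution* of $\partial_t u+\partial_x[G(u)]=0$ if, for every continuous convex $\phi:[0,K]\to\mathbb R$, with $\psi(u)=\int_0^u\phi'(w)G'(w)\,dw$, one has $\partial_t\phi(u)+\partial_x\psi(u)\le 0$ in the sense of distributions on $\mathbb R\times(0,\infty)$. It has initial datum $u_0$ if $u(\cdot,t)\to u_0$ in $L^1_{\rm loc}(\mathbb R)$ as $t\to0^+$. Let $\lambda,\rho\in\mathcal R$ with $\lambda<\rho$. Let $G_c$ be the lower convex envelope of $G$ on $[\lambda,\rho]$, let $v_*$ be its right-hand derivative at $\lambda$ and $v^*$ its left-hand derivative at $\rho$, and let $$\Sigma_{\rm low}(G)=\{v\in[v_*,v^*]:\ G_c \text{ is differentiable with derivative } v \text{ in a nonempty open subinterval of }[\lambda,\rho]\}.$$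 Let $H_c$ be a nondecreasing function on $[\lambda,\rho]$ whose one-sided limits are the one-sided derivatives of $G_c$. Let $h_c:\mathbb R\to[\lambda,\rho]$ be nondecreasing on $[v_*,v^*]$ and such that, for every $v\in[v_*,v^*]$ and $\alpha\in[\lambda,\rho]$, $\alpha<h_c(v)$ implies $H_c(\alpha)\le v$ and $\alpha>h_c(v)$ implies $H_c(\alpha)\ge v$; moreover $h_c(v)=\lambda$ for $v<v_*$ and $h_c(v)=\rho$ for $v>v^*$. **Proposition 4.1.** Such functions $H_c$, $h_c$ exist, and for any choice of them the following holds. (i) For every $v\in\mathbb R\setminus\Sigma_{\rm low}(G)$, the function $\alpha\mapsto G(\alpha)-v\alpha$ achieves its minimum over $[\lambda,\rho]$ at the unique point $h_c(v)$. Moreover $u(x,t):=h_c(x/t)$ is the entropy solution, unique up to Lebesgue-null sets of $\mathbb R\times(0,\infty)$, of $\partial_t u+\partial_x[G(u)]=0$ with Riemann initial datum $u_0(x)=\lambda\mathbf 1_{\{x<0\}}+\rho\mathbf 1_{\{x\ge0\}}$. (ii) For every $v\in\mathbb R\setminus\Sigma_{\rm low}(G)$, the minimum of $G(\alpha)-v\alpha$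 over $[\lambda,\rho]$ equals its minimum over $[\lambda,\rho]\cap\mathcal R$. The entropy solution of this Riemann problem is $\mathcal R$-valued almost everywhere on $\mathbb R\times(0,\infty)$. -/

import Mathlib

open Set Filter Topology MeasureTheory
open scoped NNReal ContDiff

noncomputable section

namespace ScalarLaw

/-- `G` interpolates linearly across every gap of `R`, that is, `G` is affine on the closure `[a, b]`
of every bounded connected component `(a, b)` of the complement of `R`. -/
def LinearOffSet (R : Set ℝ) (G : ℝ → ℝ) : Prop :=
  ∀ a ∈ R, ∀ b ∈ R, a < b → Ioo a b ∩ R = ∅ →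
    ∀ s ∈ Icc (0 : ℝ) 1, G ((1 - s) * a + s * b) = (1 - s) * G a + s * G b

/-! ### Entropy solutions of `∂ₜ u + ∂ₓ G(u) = 0` with values in `[0, K]` -/

/-- The open half-plane `ℝ × (0, ∞)` of pairs `(x, t)`. -/
def halfPlane : Set (ℝ × ℝ) := univ ×ˢ Ioi (0 : ℝ)

/-- The entropy flux `ψ(u) = ∫₀ᵘ φ'(w) G'(w) dw`. Both derivatives exist almost everywhere when
`φ` is convex and `G` is Lipschitz. -/
def entropyFlux (G φ : ℝ → ℝ) (u : ℝ) : ℝ :=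
  ∫ w in (0 : ℝ)..u, deriv φ w * deriv G w

/-- Nonnegative smooth test functions with compact support in `ℝ × (0, ∞)`. -/
structure IsTestFunction (θ : ℝ × ℝ → ℝ) : Prop where
  smooth : ContDiff ℝ ∞ θ
  compact : HasCompactSupport θ
  support : tsupport θ ⊆ halfPlane
  nonneg : ∀ p, 0 ≤ θ p

/-- `u = u(x, t)` is an entropy solution of `∂ₜ u + ∂ₓ G(u) = 0`: it is a Borel function from
`ℝ × (0, ∞)` to `[0, K]` and `∂ₜ φ(u) + ∂ₓ ψ(u) ≤ 0` in the sense of distributions on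
`ℝ × (0, ∞)` for every continuous convex `φ` on `[0, K]` with entropy flux `ψ`. -/
structure IsEntropySolution (K : ℕ) (G : ℝ → ℝ) (u : ℝ → ℝ → ℝ) : Prop where
  measurable : Measurable (fun p : ℝ × Ioi (0 : ℝ) => u p.1 (p.2 : ℝ))
  mem_Icc : ∀ x : ℝ, ∀ t : ℝ, 0 < t → u x t ∈ Icc (0 : ℝ) K
  dissipative : ∀ φ : ℝ → ℝ, ConvexOn ℝ (Icc (0 : ℝ) K) φ → ContinuousOn φ (Icc (0 : ℝ) K) →
    ∀ θ : ℝ × ℝ → ℝ, IsTestFunction θ →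
      0 ≤ ∫ p in halfPlane, (φ (u p.1 p.2) * fderiv ℝ θ p (0, 1)
        + entropyFlux G φ (u p.1 p.2) * fderiv ℝ θ p (1, 0))

/-- `u(·, t) → u₀` in `L¹_loc(ℝ)` as `t → 0+`. -/
def HasInitialDatum (u : ℝ → ℝ → ℝ) (u₀ : ℝ → ℝ) : Prop :=
  ∀ a b : ℝ, Tendsto (fun t => ∫ x in Icc a b, |u x t - u₀ x|) (𝓝[>] 0) (𝓝 0)

/-- The Riemann datum: `lam` on `x < 0` and `rho` on `x ≥ 0`. -/
def riemannDatum (lam rho : ℝ) (x : ℝ) : ℝ := if x < 0 then lam else rho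

/-- `u` is an entropy solution of the Riemann problem with states `lam` and `rho`. -/
def IsRiemannSolution (K : ℕ) (G : ℝ → ℝ) (lam rho : ℝ) (u : ℝ → ℝ → ℝ) : Prop :=
  IsEntropySolution K G u ∧ HasInitialDatum u (riemannDatum lam rho)

/-! ### The lower convex envelope on `[lam, rho]` and its slopes -/

/-- The lower convex envelope `G_c` of `G` on `[lam, rho]`: the pointwise supremum of all convex
functions on `[lam, rho]` that lie below `G` there. Only its values on `[lam, rho]` matter. -/
def envelope (G : ℝ → ℝ) (lam rho : ℝ) (α : ℝ) : ℝ :=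
  sSup {y | ∃ f : ℝ → ℝ, ConvexOn ℝ (Icc lam rho) f ∧ (∀ x ∈ Icc lam rho, f x ≤ G x) ∧ y = f α}

/-- `v_*`, the right-hand derivative of `G_c` at `lam`. -/
def vMin (G : ℝ → ℝ) (lam rho : ℝ) : ℝ := derivWithin (envelope G lam rho) (Ici lam) lam

/-- `v^*`, the left-hand derivative of `G_c` at `rho`. -/
def vMax (G : ℝ → ℝ) (lam rho : ℝ) : ℝ := derivWithin (envelope G lam rho) (Iic rho) rho

/-- `Σ_low(G)`: the `v ∈ [v_*, v^*]` such that `G_c` has derivative `v` throughout some nonempty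
open subinterval of `[lam, rho]`. -/
def sigmaLow (G : ℝ → ℝ) (lam rho : ℝ) : Set ℝ :=
  {v | v ∈ Icc (vMin G lam rho) (vMax G lam rho) ∧
    ∃ a b : ℝ, a < b ∧ Ioo a b ⊆ Icc lam rho ∧
      ∀ α ∈ Ioo a b, HasDerivAt (envelope G lam rho) v α}

/-- `H` is a nondecreasing function on `[lam, rho]` whose one-sided limits `H(α ± 0)` are the
one-sided derivatives of `G_c` at `α`. -/
structure IsEnvelopeSlope (G : ℝ → ℝ) (lam rho : ℝ) (H : ℝ → ℝ) : Prop where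
  mono : MonotoneOn H (Icc lam rho)
  right : ∀ α ∈ Ico lam rho, ∃ d : ℝ, Tendsto H (𝓝[>] α) (𝓝 d) ∧
    HasDerivWithinAt (envelope G lam rho) d (Ici α) α
  left : ∀ α ∈ Ioc lam rho, ∃ d : ℝ, Tendsto H (𝓝[<] α) (𝓝 d) ∧
    HasDerivWithinAt (envelope G lam rho) d (Iic α) α

/-- `h` is a generalized inverse `h_c` of `H = H_c`: on `[v_*, v^*]` it is a nondecreasing
`[lam, rho]`-valued function such that `α < h v` implies `H α ≤ v` and `α > h v` implies
`H α ≥ v`; it is extended by `lam` below `v_*` and by `rho` above `v^*`. -/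
structure IsSlopeInverse (G : ℝ → ℝ) (lam rho : ℝ) (H h : ℝ → ℝ) : Prop where
  mono : MonotoneOn h (Icc (vMin G lam rho) (vMax G lam rho))
  mem_Icc : ∀ v ∈ Icc (vMin G lam rho) (vMax G lam rho), h v ∈ Icc lam rho
  slope_le : ∀ v ∈ Icc (vMin G lam rho) (vMax G lam rho), ∀ α ∈ Icc lam rho, α < h v → H α ≤ v
  le_slope : ∀ v ∈ Icc (vMin G lam rho) (vMax G lam rho), ∀ α ∈ Icc lam rho, h v < α → v ≤ H α
  below : ∀ v, v < vMin G lam rho → h v = lam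
  above : ∀ v, vMax G lam rho < v → h v = rho

end ScalarLaw

end

/-! Let $k(v)$ be any minimizer of $G-v\,\cdot$ over $[\lambda,\rho]$. Adding two minimality
inequalities shows that $k$ is nondecreasing. An affine minorant of $G$ is also a minorant of $G_c$,
so $k(v)$ minimizes $G_c-v\,\cdot$ too. So does $h_c(v)$, by the sign of the one-sided slopes around
it. Two distinct minimizers of the convex function $G_c-v\,\cdot$ would make $G_c$ affine of slope
$v$ between them; hence $k=h_c$ off $\Sigma_{\rm low}(G)$ (`IsSlopeInverse.lt_of_notMem_sigmaLow`).
That set is countable, so $h_c(x/t)=k(x/t)$ almost everywhere, and the fan can be studied through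
minimality alone.

Entropy inequality. In the variable $v=x/t$ it says that $\psi(k(v))-v\,\phi(k(v))+\int_0^v\phi(k)$
is nonincreasing (`IsArgmin.antitone_primitive`). Since no regularity of $k$ is available,
increments are estimated directly: $\phi'$ is split into a nondecreasing positive part and a
nonincreasing negative part, and each is integrated against $G'-v$ using minimality at one end
(`entropyFlux_sub_le`). The error is of second order and disappears under bisection
(`antitone_of_sub_le_mul`).

Uniqueness. The entropy $(u-\alpha)^+$ with $\alpha=k(v)$ has flux at least $v(u-\alpha)^+$ on
$[\lambda,\rho]$, again by minimality. So none of it enters the region left of the ray $x=vt$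
through the ray; it vanishes there initially, hence always
(`IsEntropySolution.ae_eq_zero_of_initial`). With $(\alpha-u)^+$ on the right of the ray, any
solution is at most $k(v)$ to the left and at least $k(v)$ to the right; rational $v$ and continuity
points of $k$ force it to be $k(x/t)$ (`IsRiemannSolution.ae_eq`).

Values in $\mathcal R$. On a gap of $\mathcal R$ the function $G-v\,\cdot$ is affine, so a unique
minimizer cannot lie inside the gap (`mem_of_unique_minimizer`). -/

noncomputable section

namespace ScalarLaw

/-! ### One-sided derivatives of a Lipschitz convex function on a compact interval -/

section Slopes

variable {f : ℝ → ℝ} {a b : ℝ} {C : ℝ≥0}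

lemma abs_slope_le (hC : LipschitzOnWith C f (Icc a b)) {x y : ℝ} (hx : x ∈ Icc a b)
    (hy : y ∈ Icc a b) : |slope f x y| ≤ C := by
  rcases eq_or_ne x y with rfl | hxy
  · simp
  · rw [slope_def_field, abs_div, div_le_iff₀ (abs_pos.2 (sub_ne_zero.2 hxy.symm))]
    simpa [Real.dist_eq] using hC.dist_le_mul y hy x hx

/-- Slopes from `x` are monotone by convexity, so their limit is an infimum; the Lipschitz bound
keeps it finite even at the endpoint `a`. -/
lemma hasDerivWithinAt_right_of_convexOn (hf : ConvexOn ℝ (Icc a b) f)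
    (hC : LipschitzOnWith C f (Icc a b)) {x : ℝ} (hx : x ∈ Ico a b) :
    HasDerivWithinAt f (sInf (slope f x '' Ioo x b)) (Ioi x) x := by
  have hsub : Ioo x b ⊆ {y ∈ Icc a b | x < y} := fun z hz =>
    ⟨⟨hx.1.trans hz.1.le, hz.2.le⟩, hz.1⟩
  rw [hasDerivWithinAt_iff_tendsto_slope' self_notMem_Ioi]
  refine ((hf.monotoneOn_slope_gt ⟨hx.1, hx.2.le⟩).mono hsub).tendsto_nhdsWithin_Ioo_right
    (nonempty_Ioo.2 hx.2) ⟨-C, ?_⟩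
  rintro _ ⟨z, hz, rfl⟩
  exact (abs_le.1 (abs_slope_le hC ⟨hx.1, hx.2.le⟩ (hsub hz).1)).1

lemma hasDerivWithinAt_left_of_convexOn (hf : ConvexOn ℝ (Icc a b) f)
    (hC : LipschitzOnWith C f (Icc a b)) {x : ℝ} (hx : x ∈ Ioc a b) :
    HasDerivWithinAt f (sSup (slope f x '' Ioo a x)) (Iio x) x := by
  have hsub : Ioo a x ⊆ {y ∈ Icc a b | y < x} := fun z hz =>
    ⟨⟨hz.1.le, hz.2.le.trans hx.2⟩, hz.2⟩
  rw [hasDerivWithinAt_iff_tendsto_slope' self_notMem_Iio]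
  refine ((hf.monotoneOn_slope_lt ⟨hx.1.le, hx.2⟩).mono hsub).tendsto_nhdsWithin_Ioo_left
    (nonempty_Ioo.2 hx.1) ⟨C, ?_⟩
  rintro _ ⟨z, hz, rfl⟩
  exact (abs_le.1 (abs_slope_le hC ⟨hx.1.le, hx.2⟩ (hsub hz).1)).2

/-- A Lipschitz convex function has a monotone slope function whose one-sided limits are its
one-sided derivatives. -/
lemma exists_monotoneOn_slope (hf : ConvexOn ℝ (Icc a b) f)
    (hC : LipschitzOnWith C f (Icc a b)) :
    ∃ H : ℝ → ℝ, MonotoneOn H (Icc a b) ∧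
      (∀ x ∈ Ico a b, ∃ d : ℝ, Tendsto H (𝓝[>] x) (𝓝 d) ∧ HasDerivWithinAt f d (Ici x) x) ∧
      (∀ x ∈ Ioc a b, ∃ d : ℝ, Tendsto H (𝓝[<] x) (𝓝 d) ∧ HasDerivWithinAt f d (Iic x) x) := by
  set r : ℝ → ℝ := fun x => sInf (slope f x '' Ioo x b) with hr
  set l : ℝ → ℝ := fun x => sSup (slope f x '' Ioo a x) with hl
  have hdr : ∀ x ∈ Ico a b, HasDerivWithinAt f (r x) (Ioi x) x := fun x hx =>
    hasDerivWithinAt_right_of_convexOn hf hC hx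
  have hdl : ∀ x ∈ Ioc a b, HasDerivWithinAt f (l x) (Iio x) x := fun x hx =>
    hasDerivWithinAt_left_of_convexOn hf hC hx
  have hrs : ∀ x ∈ Icc a b, ∀ y ∈ Icc a b, x < y → r x ≤ slope f x y := fun x hx y hy hxy =>
    hf.le_slope_of_hasDerivWithinAt_Ioi hx hy hxy (hdr x ⟨hx.1, hxy.trans_le hy.2⟩)
  have hsl : ∀ x ∈ Icc a b, ∀ y ∈ Icc a b, x < y → slope f x y ≤ l y := fun x hx y hy hxy =>
    hf.slope_le_of_hasDerivWithinAt_Iio hx hy hxy (hdl y ⟨hx.1.trans_lt hxy, hy.2⟩)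
  have hsr : ∀ x ∈ Icc a b, ∀ y ∈ Ico a b, x < y → slope f x y ≤ r y := by
    intro x hx y hy hxy
    refine le_csInf ((nonempty_Ioo.2 hy.2).image _) ?_
    rintro _ ⟨z, hz, rfl⟩
    rw [slope_comm]
    exact hf.slope_mono ⟨hy.1, hy.2.le⟩ ⟨hx, hxy.ne⟩
      ⟨⟨hy.1.trans hz.1.le, hz.2.le⟩, hz.1.ne'⟩ (hxy.le.trans hz.1.le)
  have hcont : ∀ x ∈ Icc a b, ∀ y, x ≠ y →
      Tendsto (fun z => slope f z y) (𝓝[Icc a b] x) (𝓝 (slope f x y)) := by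
    intro x hx y hxy
    simp only [slope_def_field]
    refine (tendsto_const_nhds.sub (hC.continuousOn x hx)).div ?_ (sub_ne_zero.2 hxy.symm)
    exact tendsto_const_nhds.sub (tendsto_id.mono_left nhdsWithin_le_nhds)
  -- The right derivative serves everywhere except at `b`, where its infimum runs over an empty set
  -- and the left derivative takes over.
  set H : ℝ → ℝ := fun x => if x < b then r x else l x with hH
  have hHr : ∀ x, x < b → H x = r x := fun x hx => if_pos hx
  refine ⟨H, ?_, ?_, ?_⟩
  · intro x hx y hy hxy
    rcases hxy.eq_or_lt with rfl | hxy
    · rfl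
    rw [hHr x (hxy.trans_le hy.2)]
    refine (hrs x hx y hy hxy).trans ?_
    by_cases hyb : y < b
    · rw [hHr y hyb]; exact hsr x hx y ⟨hy.1, hyb⟩ hxy
    · simp only [hH, hyb, if_false]; exact hsl x hx y hy hxy
  · intro x hx
    refine ⟨r x, tendsto_order.2 ⟨fun m hm => ?_, fun m hm => ?_⟩, (hdr x hx).Ici_of_Ioi⟩
    · filter_upwards [Ioo_mem_nhdsGT hx.2] with z hz
      rw [hHr z hz.2]
      exact hm.trans_le ((hrs x ⟨hx.1, hx.2.le⟩ z ⟨hx.1.trans hz.1.le, hz.2.le⟩ hz.1).trans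
        (hsr x ⟨hx.1, hx.2.le⟩ z ⟨hx.1.trans hz.1.le, hz.2⟩ hz.1))
    -- One chord from `x` to `y` has slope below `m`. By continuity so do the chords from `z` to `y`
    -- for `z` near `x`, and these dominate `r z`.
    · obtain ⟨_, ⟨y, hy, rfl⟩, hym⟩ := exists_lt_of_csInf_lt ((nonempty_Ioo.2 hx.2).image _) hm
      have h1 : 𝓝[>] x ≤ 𝓝[Icc a b] x := by
        rw [← nhdsWithin_Ioo_eq_nhdsGT hx.2]
        exact nhdsWithin_mono _ fun z hz => ⟨hx.1.trans hz.1.le, hz.2.le⟩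
      filter_upwards [Ioo_mem_nhdsGT hy.1,
        h1 ((hcont x ⟨hx.1, hx.2.le⟩ y hy.1.ne).eventually_lt_const hym)] with z hz hzm
      rw [hHr z (hz.2.trans hy.2)]
      exact (hrs z ⟨hx.1.trans hz.1.le, (hz.2.trans hy.2).le⟩ y
        ⟨hx.1.trans hy.1.le, hy.2.le⟩ hz.2).trans_lt hzm
  · intro x hx
    refine ⟨l x, tendsto_order.2 ⟨fun m hm => ?_, fun m hm => ?_⟩, (hdl x hx).Iic_of_Iio⟩
    · obtain ⟨_, ⟨y, hy, rfl⟩, hym⟩ := exists_lt_of_lt_csSup ((nonempty_Ioo.2 hx.1).image _) hm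
      have h1 : 𝓝[<] x ≤ 𝓝[Icc a b] x := by
        rw [← nhdsWithin_Ioo_eq_nhdsLT hx.1]
        exact nhdsWithin_mono _ fun z hz => ⟨hz.1.le, hz.2.le.trans hx.2⟩
      filter_upwards [Ioo_mem_nhdsLT hy.2,
        h1 ((hcont x ⟨hx.1.le, hx.2⟩ y hy.2.ne').eventually_const_lt hym)] with z hz hzm
      have hzb : z < b := hz.2.trans_le hx.2
      rw [hHr z hzb]
      rw [slope_comm] at hzm
      exact hzm.trans_le (hsr y ⟨hy.1.le, hy.2.le.trans hx.2⟩ z ⟨hy.1.le.trans hz.1.le, hzb⟩ hz.1)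
    · filter_upwards [Ioo_mem_nhdsLT hx.1] with z hz
      have hzb : z < b := hz.2.trans_le hx.2
      rw [hHr z hzb]
      exact ((hrs z ⟨hz.1.le, hzb.le⟩ x ⟨hx.1.le, hx.2⟩ hz.2).trans
        (hsl z ⟨hz.1.le, hzb.le⟩ x ⟨hx.1.le, hx.2⟩ hz.2)).trans_lt hm

end Slopes

/-! ### The envelope -/

section Envelope

variable {G : ℝ → ℝ} {lam rho : ℝ} {C : ℝ≥0}

lemma convexOn_affine (s : Set ℝ) (hs : Convex ℝ s) (c v : ℝ) :
    ConvexOn ℝ s (fun x => c + v * x) := by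
  refine ⟨hs, fun x _ y _ p q _ _ hpq => le_of_eq ?_⟩
  simp only [smul_eq_mul]
  linear_combination (-c) * hpq

lemma le_envelope {f : ℝ → ℝ} (hf : ConvexOn ℝ (Icc lam rho) f) (hfG : ∀ x ∈ Icc lam rho, f x ≤ G x)
    {x : ℝ} (hx : x ∈ Icc lam rho) : f x ≤ envelope G lam rho x := by
  refine le_csSup ⟨G x, ?_⟩ ⟨f, hf, hfG, rfl⟩
  rintro _ ⟨g, -, hg, rfl⟩
  exact hg x hx

lemma affine_le_envelope {c v : ℝ} (h : ∀ x ∈ Icc lam rho, c + v * x ≤ G x)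
    {x : ℝ} (hx : x ∈ Icc lam rho) : c + v * x ≤ envelope G lam rho x :=
  le_envelope (f := fun x => c + v * x) (convexOn_affine _ (convex_Icc _ _) c v) h hx

/-- A line through the left end value of `G`: it shows that the supremum defining the envelope is
over a nonempty set, and it bounds the slopes at `lam`. `lower_right` does the same at `rho`. -/
lemma lower_left (hC : LipschitzOnWith C G (Icc lam rho)) {x : ℝ} (hx : x ∈ Icc lam rho) :
    (G lam + C * lam) + (-C) * x ≤ G x := by
  have h := hC.dist_le_mul x hx lam ⟨le_rfl, hx.1.trans hx.2⟩
  rw [Real.dist_eq, Real.dist_eq, abs_of_nonneg (sub_nonneg.2 hx.1)] at h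
  linarith [(abs_le.1 h).1]

lemma lower_right (hC : LipschitzOnWith C G (Icc lam rho)) {x : ℝ} (hx : x ∈ Icc lam rho) :
    (G rho - C * rho) + C * x ≤ G x := by
  have h := hC.dist_le_mul x hx rho ⟨hx.1.trans hx.2, le_rfl⟩
  rw [Real.dist_eq, Real.dist_eq, abs_of_nonpos (sub_nonpos.2 hx.2)] at h
  linarith [(abs_le.1 h).1]

lemma envelope_le (hC : LipschitzOnWith C G (Icc lam rho)) {x B : ℝ}
    (hB : ∀ f : ℝ → ℝ, ConvexOn ℝ (Icc lam rho) f → (∀ x ∈ Icc lam rho, f x ≤ G x) → f x ≤ B) :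
    envelope G lam rho x ≤ B := by
  refine csSup_le ⟨_, _, convexOn_affine _ (convex_Icc _ _) _ _, fun _ => lower_left hC, rfl⟩ ?_
  rintro _ ⟨f, hf, hfG, rfl⟩
  exact hB f hf hfG

lemma envelope_le_self (hC : LipschitzOnWith C G (Icc lam rho)) {x : ℝ} (hx : x ∈ Icc lam rho) :
    envelope G lam rho x ≤ G x :=
  envelope_le hC fun _ _ h => h x hx

lemma convexOn_envelope (hC : LipschitzOnWith C G (Icc lam rho)) :
    ConvexOn ℝ (Icc lam rho) (envelope G lam rho) := by
  refine ⟨convex_Icc _ _, fun x hx y hy p q hp hq hpq => ?_⟩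
  refine envelope_le hC fun f hf hfG => ?_
  refine (hf.2 hx hy hp hq hpq).trans ?_
  simp only [smul_eq_mul]
  gcongr
  · exact le_envelope hf hfG hx
  · exact le_envelope hf hfG hy

/-- Chord slopes of a convex function are squeezed between those of chords ending at `lam` and at
`rho`, which the two lines of slope `-C` and `C` control. -/
lemma lipschitzOnWith_envelope (hlt : lam < rho) (hC : LipschitzOnWith C G (Icc lam rho)) :
    LipschitzOnWith C (envelope G lam rho) (Icc lam rho) := by
  have hl : lam ∈ Icc lam rho := ⟨le_rfl, hlt.le⟩
  have hr : rho ∈ Icc lam rho := ⟨hlt.le, le_rfl⟩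
  have hcv := convexOn_envelope hC
  have key : ∀ x ∈ Icc lam rho, ∀ y ∈ Icc lam rho, x < y →
      |envelope G lam rho y - envelope G lam rho x| ≤ C * (y - x) := by
    intro x hx y hy hxy
    have hpos : 0 < y - x := sub_pos.2 hxy
    have h1 : -(C : ℝ) ≤ slope (envelope G lam rho) lam y := by
      rw [slope_def_field, le_div_iff₀ (sub_pos.2 (hx.1.trans_lt hxy))]
      linarith [affine_le_envelope (fun x hx => lower_left hC hx) hy, envelope_le_self hC hl]
    have h2 : slope (envelope G lam rho) x rho ≤ C := by
      rw [slope_def_field, div_le_iff₀ (sub_pos.2 (hxy.trans_le hy.2))]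
      linarith [affine_le_envelope (fun x hx => lower_right hC hx) hx, envelope_le_self hC hr]
    have h3 : slope (envelope G lam rho) lam y ≤ slope (envelope G lam rho) x y := by
      rw [slope_comm _ lam, slope_comm _ x]
      exact hcv.slope_mono hy ⟨hl, (hx.1.trans_lt hxy).ne⟩ ⟨hx, hxy.ne⟩ hx.1
    have h4 : slope (envelope G lam rho) x y ≤ slope (envelope G lam rho) x rho :=
      hcv.slope_mono hx ⟨hy, hxy.ne'⟩ ⟨hr, (hxy.trans_le hy.2).ne'⟩ hy.2
    have h5 := h1.trans h3
    have h6 := h4.trans h2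
    rw [slope_def_field, le_div_iff₀ hpos] at h5
    rw [slope_def_field, div_le_iff₀ hpos] at h6
    exact abs_le.2 ⟨by linarith, h6⟩
  refine LipschitzOnWith.of_dist_le_mul fun x hx y hy => ?_
  rw [Real.dist_eq, Real.dist_eq]
  rcases lt_trichotomy x y with h | h | h
  · rw [abs_sub_comm, abs_sub_comm x, abs_of_pos (sub_pos.2 h)]; exact key x hx y hy h
  · simp [h]
  · rw [abs_of_pos (sub_pos.2 h)]; exact key y hy x hx h

theorem exists_isEnvelopeSlope (hlt : lam < rho) (hC : LipschitzOnWith C G (Icc lam rho)) :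
    ∃ H, IsEnvelopeSlope G lam rho H := by
  obtain ⟨H, h1, h2, h3⟩ := exists_monotoneOn_slope (convexOn_envelope hC)
    (lipschitzOnWith_envelope hlt hC)
  exact ⟨H, h1, h2, h3⟩

theorem exists_isSlopeInverse (hlt : lam < rho) {H : ℝ → ℝ} (hH : IsEnvelopeSlope G lam rho H)
    (hv : vMin G lam rho ≤ vMax G lam rho) : ∃ h, IsSlopeInverse G lam rho H h := by
  -- The inverse is the supremum of a sublevel set of `H`; inserting `lam` makes the set nonempty
  -- without further argument.
  set S : ℝ → Set ℝ := fun v => insert lam {x ∈ Icc lam rho | H x ≤ v} with hS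
  have hSsub : ∀ v, S v ⊆ Icc lam rho := fun v =>
    insert_subset ⟨le_rfl, hlt.le⟩ (sep_subset _ _)
  have hbdd : ∀ v, BddAbove (S v) := fun v => ⟨rho, fun x hx => (hSsub v hx).2⟩
  have hne : ∀ v, (S v).Nonempty := fun v => insert_nonempty _ _
  set h : ℝ → ℝ := fun v => if v < vMin G lam rho then lam else
    if vMax G lam rho < v then rho else sSup (S v) with hh
  have hval : ∀ v ∈ Icc (vMin G lam rho) (vMax G lam rho), h v = sSup (S v) := fun v hv => by
    simp only [hh, not_lt.2 hv.1, not_lt.2 hv.2, if_false]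
  refine ⟨h, ?_, ?_, ?_, ?_, ?_, ?_⟩
  · intro v hv w hw hvw
    rw [hval v hv, hval w hw]
    exact csSup_le_csSup (hbdd w) (hne v)
      (insert_subset_insert fun x hx => ⟨hx.1, hx.2.trans hvw⟩)
  · intro v hv
    rw [hval v hv]
    exact ⟨le_csSup (hbdd v) (mem_insert _ _), csSup_le (hne v) fun x hx => (hSsub v hx).2⟩
  · intro v hv x hx hxv
    rw [hval v hv] at hxv
    obtain ⟨y, hy, hxy⟩ := exists_lt_of_lt_csSup (hne v) hxv
    rcases hy with rfl | hy
    · exact absurd hx.1 (not_le.2 hxy)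
    · exact (hH.mono hx hy.1 hxy.le).trans hy.2
  · intro v hv x hx hxv
    rw [hval v hv] at hxv
    by_contra hcon
    exact absurd (le_csSup (hbdd v) (mem_insert_of_mem _ ⟨hx, (not_le.1 hcon).le⟩)) (not_le.2 hxv)
  · intro v hv
    simp only [hh, hv, if_true]
  · intro v hv'
    simp only [hh, not_lt.2 (hv.trans hv'.le), hv', if_false, if_true]

/-! ### Slopes outside `sigmaLow`: the generalized inverse is the unique minimizer. -/

section Characterization

variable {H h : ℝ → ℝ}

lemma IsEnvelopeSlope.hasDerivWithinAt_vMin (hlt : lam < rho) (hH : IsEnvelopeSlope G lam rho H) :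
    HasDerivWithinAt (envelope G lam rho) (vMin G lam rho) (Ici lam) lam := by
  obtain ⟨d, -, hd⟩ := hH.right lam ⟨le_rfl, hlt⟩
  exact hd.differentiableWithinAt.hasDerivWithinAt

lemma IsEnvelopeSlope.hasDerivWithinAt_vMax (hlt : lam < rho) (hH : IsEnvelopeSlope G lam rho H) :
    HasDerivWithinAt (envelope G lam rho) (vMax G lam rho) (Iic rho) rho := by
  obtain ⟨d, -, hd⟩ := hH.left rho ⟨hlt, le_rfl⟩
  exact hd.differentiableWithinAt.hasDerivWithinAt

lemma IsEnvelopeSlope.vMin_le_slope (hlt : lam < rho) (hC : LipschitzOnWith C G (Icc lam rho))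
    (hH : IsEnvelopeSlope G lam rho H) {x : ℝ} (hx : x ∈ Ioc lam rho) :
    vMin G lam rho ≤ slope (envelope G lam rho) lam x :=
  (convexOn_envelope hC).le_slope_of_hasDerivWithinAt_Ioi ⟨le_rfl, hlt.le⟩ ⟨hx.1.le, hx.2⟩ hx.1
    ((hH.hasDerivWithinAt_vMin hlt).mono Ioi_subset_Ici_self)

lemma IsEnvelopeSlope.slope_le_vMax (hlt : lam < rho) (hC : LipschitzOnWith C G (Icc lam rho))
    (hH : IsEnvelopeSlope G lam rho H) {x : ℝ} (hx : x ∈ Ico lam rho) :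
    slope (envelope G lam rho) x rho ≤ vMax G lam rho :=
  (convexOn_envelope hC).slope_le_of_hasDerivWithinAt_Iio ⟨hx.1, hx.2.le⟩ ⟨hlt.le, le_rfl⟩ hx.2
    ((hH.hasDerivWithinAt_vMax hlt).mono Iio_subset_Iic_self)

lemma IsEnvelopeSlope.vMin_le_vMax (hlt : lam < rho) (hC : LipschitzOnWith C G (Icc lam rho))
    (hH : IsEnvelopeSlope G lam rho H) : vMin G lam rho ≤ vMax G lam rho :=
  (hH.vMin_le_slope hlt hC ⟨hlt, le_rfl⟩).trans (hH.slope_le_vMax hlt hC ⟨le_rfl, hlt⟩)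

lemma IsSlopeInverse.mem_Icc_all (hlt : lam < rho) (hh : IsSlopeInverse G lam rho H h) (v : ℝ) :
    h v ∈ Icc lam rho := by
  by_cases h1 : v < vMin G lam rho
  · rw [hh.below v h1]; exact ⟨le_rfl, hlt.le⟩
  by_cases h2 : vMax G lam rho < v
  · rw [hh.above v h2]; exact ⟨hlt.le, le_rfl⟩
  exact hh.mem_Icc v ⟨not_lt.1 h1, not_lt.1 h2⟩

/-- `h v` minimizes `G_c - v ·`, strictly when `v` is outside `[v_*, v^*]`. -/
lemma IsSlopeInverse.envelope_min (hlt : lam < rho) (hC : LipschitzOnWith C G (Icc lam rho))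
    (hH : IsEnvelopeSlope G lam rho H) (hh : IsSlopeInverse G lam rho H h) (v : ℝ)
    {x : ℝ} (hx : x ∈ Icc lam rho) (hxv : x ≠ h v) :
    envelope G lam rho (h v) - v * h v ≤ envelope G lam rho x - v * x ∧
      (v ∉ Icc (vMin G lam rho) (vMax G lam rho) →
        envelope G lam rho (h v) - v * h v < envelope G lam rho x - v * x) := by
  have hcv := convexOn_envelope hC
  by_cases h1 : v < vMin G lam rho
  · rw [hh.below v h1] at hxv ⊢
    have hx' : lam < x := lt_of_le_of_ne hx.1 hxv.symm
    have h2 := hH.vMin_le_slope hlt hC ⟨hx', hx.2⟩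
    rw [slope_def_field, le_div_iff₀ (sub_pos.2 hx')] at h2
    have h3 := mul_lt_mul_of_pos_right h1 (sub_pos.2 hx')
    exact ⟨by linarith, fun _ => by linarith⟩
  by_cases h2 : vMax G lam rho < v
  · rw [hh.above v h2] at hxv ⊢
    have hx' : x < rho := lt_of_le_of_ne hx.2 hxv
    have h3 := hH.slope_le_vMax hlt hC ⟨hx.1, hx'⟩
    rw [slope_def_field, div_le_iff₀ (sub_pos.2 hx')] at h3
    have h4 := mul_lt_mul_of_pos_right h2 (sub_pos.2 hx')
    exact ⟨by linarith, fun _ => by linarith⟩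
  have hv : v ∈ Icc (vMin G lam rho) (vMax G lam rho) := ⟨not_lt.1 h1, not_lt.1 h2⟩
  refine ⟨?_, fun h => absurd hv h⟩
  have hm := hh.mem_Icc v hv
  rcases lt_or_gt_of_ne hxv with hlt' | hgt
  -- `H` is at most `v` on the left of `h v`, hence so is its limit, the left derivative, which
  -- bounds every chord ending at `h v`.
  · obtain ⟨d, hd, hd'⟩ := hH.left (h v) ⟨hx.1.trans_lt hlt', hm.2⟩
    have hdv : d ≤ v := by
      refine le_of_tendsto hd ?_
      filter_upwards [Ioo_mem_nhdsLT hlt'] with z hz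
      exact hh.slope_le v hv z ⟨hx.1.trans hz.1.le, hz.2.le.trans hm.2⟩ hz.2
    have h5 := (hcv.slope_le_of_hasDerivWithinAt_Iio hx hm hlt'
      (hd'.mono Iio_subset_Iic_self)).trans hdv
    rw [slope_def_field, div_le_iff₀ (sub_pos.2 hlt')] at h5
    linarith
  · obtain ⟨d, hd, hd'⟩ := hH.right (h v) ⟨hm.1, hgt.trans_le hx.2⟩
    have hdv : v ≤ d := by
      refine ge_of_tendsto hd ?_
      filter_upwards [Ioo_mem_nhdsGT hgt] with z hz
      exact hh.le_slope v hv z ⟨hm.1.trans hz.1.le, hz.2.le.trans hx.2⟩ hz.1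
    have h5 := hdv.trans (hcv.le_slope_of_hasDerivWithinAt_Ioi hm hx hgt
      (hd'.mono Ioi_subset_Ici_self))
    rw [slope_def_field, le_div_iff₀ (sub_pos.2 hgt)] at h5
    linarith

/-- Between two minimizers, convexity bounds the function above by the common minimum and minimality
bounds it below, so the envelope is affine of slope `v` there. -/
lemma mem_sigmaLow_of_two_minimizers (hC : LipschitzOnWith C G (Icc lam rho)) {v x y : ℝ}
    (hv : v ∈ Icc (vMin G lam rho) (vMax G lam rho)) (hx : x ∈ Icc lam rho) (hy : y ∈ Icc lam rho)
    (hxy : x < y)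
    (hmin : ∀ z ∈ Icc lam rho, envelope G lam rho x - v * x ≤ envelope G lam rho z - v * z)
    (heq : envelope G lam rho x - v * x = envelope G lam rho y - v * y) :
    v ∈ sigmaLow G lam rho := by
  refine ⟨hv, x, y, hxy, fun z hz => ⟨hx.1.trans hz.1.le, hz.2.le.trans hy.2⟩, fun z hz => ?_⟩
  have hval : ∀ z ∈ Ioo x y, envelope G lam rho z = (envelope G lam rho x - v * x) + v * z := by
    intro z hz
    have hz' : z ∈ Icc lam rho := ⟨hx.1.trans hz.1.le, hz.2.le.trans hy.2⟩
    refine le_antisymm ?_ (by linarith [hmin z hz'])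
    have hpos : 0 < y - x := sub_pos.2 hxy
    have hp : 0 ≤ (y - z) / (y - x) := div_nonneg (by linarith [hz.2]) hpos.le
    have hq : 0 ≤ (z - x) / (y - x) := div_nonneg (by linarith [hz.1]) hpos.le
    have h2 := (convexOn_envelope hC).2 hx hy hp hq (by field_simp; ring)
    have h3 : ((y - z) / (y - x)) • x + ((z - x) / (y - x)) • y = z := by
      simp only [smul_eq_mul]; field_simp; ring
    rw [h3] at h2
    refine h2.trans (le_of_eq ?_)
    have h4 : envelope G lam rho y = envelope G lam rho x - v * x + v * y := by linarith
    rw [h4]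
    simp only [smul_eq_mul]
    field_simp
    ring
  have h1 : HasDerivAt (fun z => (envelope G lam rho x - v * x) + v * z) v z := by
    simpa using ((hasDerivAt_id z).const_mul v).const_add (envelope G lam rho x - v * x)
  refine h1.congr_of_eventuallyEq ?_
  filter_upwards [Ioo_mem_nhds hz.1 hz.2] with w hw using hval w hw

lemma exists_minimizer (hlt : lam < rho) (hC : LipschitzOnWith C G (Icc lam rho)) (v : ℝ) :
    ∃ x ∈ Icc lam rho, ∀ y ∈ Icc lam rho, G x - v * x ≤ G y - v * y := by
  have hcont : ContinuousOn (fun x => G x - v * x) (Icc lam rho) :=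
    hC.continuousOn.sub (by fun_prop)
  obtain ⟨x, hx, hmin⟩ := isCompact_Icc.exists_isMinOn (nonempty_Icc.2 hlt.le) hcont
  exact ⟨x, hx, fun y hy => hmin hy⟩

/-- `h v` is the only minimizer of the envelope minus `v ·`. A minimizer `z` of `G - v ·` supplies
an affine minorant of `G` touching it at `z`; the minorant also lies below the envelope, so `z`
minimizes there too and equals `h v`. Compactness supplies such a `z`. -/
theorem IsSlopeInverse.lt_of_notMem_sigmaLow (hlt : lam < rho)
    (hC : LipschitzOnWith C G (Icc lam rho)) (hH : IsEnvelopeSlope G lam rho H)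
    (hh : IsSlopeInverse G lam rho H h) {v : ℝ} (hv : v ∉ sigmaLow G lam rho)
    {x : ℝ} (hx : x ∈ Icc lam rho) (hxv : x ≠ h v) : G (h v) - v * h v < G x - v * x := by
  have hm := hh.mem_Icc_all hlt v
  have hle : ∀ z ∈ Icc lam rho,
      envelope G lam rho (h v) - v * h v ≤ envelope G lam rho z - v * z := by
    intro z hz
    rcases eq_or_ne z (h v) with rfl | hne
    · rfl
    · exact (hh.envelope_min hlt hC hH v hz hne).1
  have huniq : ∀ z ∈ Icc lam rho, z ≠ h v →
      envelope G lam rho (h v) - v * h v < envelope G lam rho z - v * z := by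
    intro z hz hne
    by_cases hvI : v ∈ Icc (vMin G lam rho) (vMax G lam rho)
    · refine lt_of_le_of_ne (hle z hz) fun heq => hv ?_
      rcases lt_or_gt_of_ne hne with hlt' | hgt
      · exact mem_sigmaLow_of_two_minimizers hC hvI hz hm hlt'
          (fun w hw => heq ▸ hle w hw) heq.symm
      · exact mem_sigmaLow_of_two_minimizers hC hvI hm hz hgt hle heq
    · exact (hh.envelope_min hlt hC hH v hz hne).2 hvI
  have hGmin : ∀ z ∈ Icc lam rho, (∀ y ∈ Icc lam rho, G z - v * z ≤ G y - v * y) → z = h v := by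
    intro z hz hmin
    by_contra hne
    have h1 := affine_le_envelope (G := G) (c := G z - v * z) (v := v)
      (fun x hx => by linarith [hmin x hx]) hm
    linarith [huniq z hz hne, envelope_le_self hC hz]
  obtain ⟨z, hz, hzmin⟩ := exists_minimizer hlt hC v
  have hzv := hGmin z hz hzmin
  subst hzv
  refine lt_of_le_of_ne (hzmin x hx) fun heq => hxv (hGmin x hx fun y hy => ?_)
  exact heq ▸ hzmin y hy

end Characterization

/-- A rational point of the interval where the envelope has slope `v` determines `v` as the
derivative at that point. -/
lemma countable_sigmaLow : (sigmaLow G lam rho).Countable := by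
  have hex : ∀ v : sigmaLow G lam rho, ∃ q : ℚ, HasDerivAt (envelope G lam rho) v q := by
    rintro ⟨v, -, a, b, hab, -, hd⟩
    obtain ⟨q, h1, h2⟩ := exists_rat_btwn hab
    exact ⟨q, hd q ⟨h1, h2⟩⟩
  choose q hq using hex
  refine countable_coe_iff.1 (Function.Injective.countable (f := q) fun v w hvw => ?_)
  exact Subtype.ext ((hq v).unique (hvw ▸ hq w))

end Envelope

/-- A unique minimizer of `G - v ·` cannot lie in a gap of `R`, where `G` is affine. -/
lemma mem_of_unique_minimizer {R : Set ℝ} (hR : IsClosed R) {G : ℝ → ℝ} (hG : LinearOffSet R G)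
    {lam rho : ℝ} (hlam : lam ∈ R) (hrho : rho ∈ R) {v α : ℝ} (hα : α ∈ Icc lam rho)
    (hmin : ∀ x ∈ Icc lam rho, x ≠ α → G α - v * α < G x - v * x) : α ∈ R := by
  by_contra hαR
  have hc1 : IsCompact (R ∩ Icc lam α) := isCompact_Icc.inter_left hR
  have hc2 : IsCompact (R ∩ Icc α rho) := isCompact_Icc.inter_left hR
  obtain ⟨haR, ha⟩ := hc1.sSup_mem ⟨lam, hlam, le_rfl, hα.1⟩
  obtain ⟨hbR, hb⟩ := hc2.sInf_mem ⟨rho, hrho, hα.2, le_rfl⟩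
  -- The points of `R` nearest to `α` on either side bound the gap that contains `α`.
  set a := sSup (R ∩ Icc lam α)
  set b := sInf (R ∩ Icc α rho)
  have haα : a < α := lt_of_le_of_ne ha.2 fun h => hαR (h ▸ haR)
  have hαb : α < b := lt_of_le_of_ne hb.1 fun h => hαR (h ▸ hbR)
  have hgap : Ioo a b ∩ R = ∅ := by
    refine eq_empty_of_forall_notMem fun x hx => ?_
    rcases le_total x α with h | h
    · exact absurd (le_csSup hc1.bddAbove ⟨hx.2, ha.1.trans hx.1.1.le, h⟩) (not_le.2 hx.1.1)
    · exact absurd (csInf_le hc2.bddBelow ⟨hx.2, h, hx.1.2.le.trans hb.2⟩) (not_le.2 hx.1.2)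
  have hpos : 0 < b - a := by linarith
  set s := (α - a) / (b - a) with hs
  have hs0 : 0 < s := div_pos (by linarith) hpos
  have hs1 : s < 1 := (div_lt_one hpos).2 (by linarith)
  have hsα : (1 - s) * a + s * b = α := by rw [hs]; field_simp; ring
  have hlin := hG a haR b hbR (haα.trans hαb) hgap s ⟨hs0.le, hs1.le⟩
  rw [hsα] at hlin
  -- The strict inequalities at the two ends, averaged with weights `1 - s` and `s`, contradict the
  -- affine identity at `α`.
  have h1 := hmin a ⟨ha.1, ha.2.trans hα.2⟩ haα.ne
  have h2 := hmin b ⟨hα.1.trans hb.1, hb.2⟩ hαb.ne'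
  have h3 := mul_lt_mul_of_pos_left h1 (sub_pos.2 hs1)
  have h4 := mul_lt_mul_of_pos_left h2 hs0
  have h5 : v * ((1 - s) * a + s * b) = v * α := by rw [hsα]
  nlinarith

/-! ### Integration against monotone weights -/

lemma lintegral_ofReal_le_of_integral_nonpos {X : Type*} [MeasurableSpace X] {μ : Measure X}
    {g : X → ℝ} (hg : Integrable g μ) (h : ∫ x, g x ∂μ ≤ 0) :
    ∫⁻ x, ENNReal.ofReal (g x) ∂μ ≤ ∫⁻ x, ENNReal.ofReal (-g x) ∂μ := by
  rw [integral_eq_lintegral_pos_part_sub_lintegral_neg_part hg, sub_nonpos] at h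
  exact (ENNReal.toReal_le_toReal hg.lintegral_lt_top.ne hg.neg.lintegral_lt_top.ne).1 h

/-- A nonnegative nondecreasing weight preserves the sign of the tail integrals. -/
lemma integral_mul_nonpos_of_monotoneOn {q g : ℝ → ℝ} {a b : ℝ} (hab : a ≤ b)
    (hq : MonotoneOn q (Ioo a b)) (hq0 : ∀ x, 0 ≤ q x) (hg : IntervalIntegrable g volume a b)
    (htail : ∀ c ∈ Icc a b, ∫ x in c..b, g x ≤ 0) : ∫ x in a..b, q x * g x ≤ 0 := by
  rw [intervalIntegral.integral_of_le hab, integral_Ioc_eq_integral_Ioo]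
  have hgI : IntegrableOn g (Ioo a b) :=
    ((intervalIntegrable_iff_integrableOn_Ioc_of_le hab).1 hg).mono_set Ioo_subset_Ioc_self
  -- Without integrability the Bochner integral is `0` by convention, and the bound is trivial.
  by_cases hint : IntegrableOn (fun x => q x * g x) (Ioo a b)
  swap
  · exact (integral_undef hint).le
  set μ := volume.restrict (Ioo a b) with hμ
  have hqm : AEMeasurable q μ := aemeasurable_restrict_of_monotoneOn measurableSet_Ioo hq
  have hgm : AEMeasurable g μ := hgI.aestronglyMeasurable.aemeasurable
  -- Layer cake: a superlevel set of a nondecreasing `q` is, up to a null set, an interval ending at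
  -- `b`, where the tail hypothesis applies. The positive and negative parts of `g` are used as
  -- densities, so that integration over levels needs no further integrability.
  have hlevel : ∀ t : ℝ, (μ.withDensity fun x => ENNReal.ofReal (g x)) {x | t < q x} ≤
      (μ.withDensity fun x => ENNReal.ofReal (-g x)) {x | t < q x} := by
    intro t
    rw [withDensity_apply' _ _, withDensity_apply' _ _, hμ,
      Measure.restrict_restrict' measurableSet_Ioo]
    set S := {x | t < q x} ∩ Ioo a b with hS
    rcases S.eq_empty_or_nonempty with hemp | hne
    · simp [hemp]
    have hbdd : BddBelow S := ⟨a, fun x hx => hx.2.1.le⟩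
    have hc : sInf S ∈ Icc a b :=
      ⟨le_csInf hne fun x hx => hx.2.1.le,
        hne.elim fun x hx => (csInf_le hbdd hx).trans hx.2.2.le⟩
    have hSae : S =ᵐ[volume] Ioo (sInf S) b := by
      refine EventuallyLE.antisymm ?_ (LE.le.eventuallyLE ?_)
      · refine EventuallyLE.trans (LE.le.eventuallyLE ?_) Ioo_ae_eq_Ico.symm.le
        exact fun x hx => ⟨csInf_le hbdd hx, hx.2.2⟩
      · intro x hx
        obtain ⟨y, hy, hyx⟩ := exists_lt_of_csInf_lt hne hx.1
        have hx' : x ∈ Ioo a b := ⟨hy.2.1.trans hyx, hx.2⟩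
        exact ⟨lt_of_lt_of_le hy.1 (hq hy.2 hx' hyx.le), hx'⟩
    rw [Measure.restrict_congr_set hSae]
    refine lintegral_ofReal_le_of_integral_nonpos
      (hgI.mono_set (Ioo_subset_Ioo_left hc.1)) ?_
    rw [← integral_Ioc_eq_integral_Ioo, ← intervalIntegral.integral_of_le hc.2]
    exact htail _ hc
  have hlay : ∀ f : ℝ → ENNReal, AEMeasurable f μ →
      ∫⁻ x, ENNReal.ofReal (q x) * f x ∂μ =
        ∫⁻ t in Ioi (0 : ℝ), (μ.withDensity f) {x | t < q x} := by
    intro f hf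
    rw [← lintegral_eq_lintegral_meas_lt _ (Eventually.of_forall hq0)
      (hqm.mono_ac (withDensity_absolutelyContinuous _ _)),
      lintegral_withDensity_eq_lintegral_mul₀ hf hqm.ennreal_ofReal]
    simp only [Pi.mul_apply, mul_comm]
  have hkey : ∫⁻ x, ENNReal.ofReal (q x * g x) ∂μ ≤ ∫⁻ x, ENNReal.ofReal (-(q x * g x)) ∂μ := by
    simp only [← mul_neg, ENNReal.ofReal_mul (hq0 _)]
    rw [hlay _ hgm.ennreal_ofReal, hlay (fun x => ENNReal.ofReal (-g x)) hgm.neg.ennreal_ofReal]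
    exact lintegral_mono fun t => hlevel t
  rw [integral_eq_lintegral_pos_part_sub_lintegral_neg_part hint, sub_nonpos]
  exact (ENNReal.toReal_le_toReal hint.lintegral_lt_top.ne hint.neg.lintegral_lt_top.ne).2 hkey

/-- Mirror image of the monotone case under `x ↦ -x`. -/
lemma integral_mul_nonneg_of_antitoneOn {q g : ℝ → ℝ} {a b : ℝ} (hab : a ≤ b)
    (hq : AntitoneOn q (Ioo a b)) (hq0 : ∀ x, 0 ≤ q x) (hg : IntervalIntegrable g volume a b)
    (htail : ∀ c ∈ Icc a b, 0 ≤ ∫ x in a..c, g x) : 0 ≤ ∫ x in a..b, q x * g x := by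
  have h := integral_mul_nonpos_of_monotoneOn (q := fun x => q (-x)) (g := fun x => -g (-x))
    (a := -b) (b := -a) (neg_le_neg hab) ?_ (fun x => hq0 _) ?_ ?_
  · simp only [mul_neg, intervalIntegral.integral_neg] at h
    rw [intervalIntegral.integral_comp_neg (fun x => q x * g x)] at h
    simpa using h
  · intro x hx y hy hxy
    exact hq ⟨by linarith [hy.2], by linarith [hy.1]⟩ ⟨by linarith [hx.2], by linarith [hx.1]⟩
      (neg_le_neg hxy)
  · exact ((IntervalIntegrable.iff_comp_neg (h := enorm_ne_top)).1 hg).symm.neg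
  · intro c hc
    rw [intervalIntegral.integral_neg, intervalIntegral.integral_comp_neg (fun x => g x)]
    have := htail (-c) ⟨by linarith [hc.2], by linarith [hc.1]⟩
    simpa using this

/-! ### Derivatives of continuous convex functions -/

section Convex

variable {φ : ℝ → ℝ} {a b : ℝ}

/-- The derivative may be unbounded at both ends. Subtracting its value at an interior point gives
it a constant sign on each side, and a derivative of constant sign of a continuous function is
integrable. -/
lemma intervalIntegrable_rightDeriv (hab : a < b) (hφ : ConvexOn ℝ (Icc a b) φ)
    (hc : ContinuousOn φ (Icc a b)) :
    IntervalIntegrable (fun x => derivWithin φ (Ioi x) x) volume a b := by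
  set r : ℝ → ℝ := fun x => derivWithin φ (Ioi x) x with hr
  have hmono : MonotoneOn r (Ioo a b) := by
    have := hφ.monotoneOn_rightDeriv
    rwa [interior_Icc] at this
  have hd : ∀ x ∈ Ioo a b, HasDerivWithinAt φ (r x) (Ioi x) x := fun x hx =>
    hφ.hasDerivWithinAt_rightDeriv_of_mem_interior (by rwa [interior_Icc])
  obtain ⟨c, hac, hcb⟩ := exists_between hab
  have h1 : IntervalIntegrable (fun x => r c - r x) volume a c := by
    rw [intervalIntegrable_iff_integrableOn_Ioc_of_le hac.le]
    refine intervalIntegral.integrableOn_deriv_right_of_nonneg (g := fun x => r c * x - φ x)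
      (ContinuousOn.sub (by fun_prop) (hc.mono (Icc_subset_Icc_right hcb.le))) ?_ ?_
    · intro x hx
      have h := ((hasDerivAt_id x).const_mul (r c)).hasDerivWithinAt (s := Ioi x)
      rw [mul_one] at h
      exact h.sub (hd x ⟨hx.1, hx.2.trans hcb⟩)
    · intro x hx
      exact sub_nonneg.2 (hmono ⟨hx.1, hx.2.trans hcb⟩ ⟨hac, hcb⟩ hx.2.le)
  have h2 : IntervalIntegrable (fun x => r x - r c) volume c b := by
    rw [intervalIntegrable_iff_integrableOn_Ioc_of_le hcb.le]
    refine intervalIntegral.integrableOn_deriv_right_of_nonneg (g := fun x => φ x - r c * x)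
      (ContinuousOn.sub (hc.mono (Icc_subset_Icc_left hac.le)) (by fun_prop)) ?_ ?_
    · intro x hx
      have h := ((hasDerivAt_id x).const_mul (r c)).hasDerivWithinAt (s := Ioi x)
      rw [mul_one] at h
      exact (hd x ⟨hac.trans hx.1, hx.2⟩).sub h
    · intro x hx
      exact sub_nonneg.2 (hmono ⟨hac, hcb⟩ ⟨hac.trans hx.1, hx.2⟩ hx.1.le)
  have h1' := (intervalIntegrable_const (c := r c) (μ := volume) (a := a) (b := c)).sub h1
  have h2' := (intervalIntegrable_const (c := r c) (μ := volume) (a := c) (b := b)).add h2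
  simp only [sub_sub_cancel, add_sub_cancel] at h1' h2'
  exact h1'.trans h2'

lemma integral_rightDeriv (hab : a < b) (hφ : ConvexOn ℝ (Icc a b) φ)
    (hc : ContinuousOn φ (Icc a b)) {x y : ℝ} (hx : x ∈ Icc a b) (hy : y ∈ Icc a b) :
    ∫ w in x..y, derivWithin φ (Ioi w) w = φ y - φ x := by
  have hsub : uIcc x y ⊆ Icc a b := uIcc_subset_Icc hx hy
  refine intervalIntegral.integral_eq_sub_of_hasDeriv_right (hc.mono hsub) (fun w hw => ?_) ?_
  · refine hφ.hasDerivWithinAt_rightDeriv_of_mem_interior ?_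
    rw [interior_Icc]
    exact ⟨(le_min hx.1 hy.1).trans_lt hw.1, hw.2.trans_le (max_le hx.2 hy.2)⟩
  · refine (intervalIntegrable_rightDeriv hab hφ hc).mono_set ?_
    rwa [uIcc_of_le hab.le]

/-- Lebesgue differentiation, since `φ` is a primitive of its right derivative. -/
lemma ae_hasDerivAt_rightDeriv (hab : a < b) (hφ : ConvexOn ℝ (Icc a b) φ)
    (hc : ContinuousOn φ (Icc a b)) :
    ∀ᵐ x, x ∈ Ioo a b → HasDerivAt φ (derivWithin φ (Ioi x) x) x := by
  filter_upwards [(intervalIntegrable_rightDeriv hab hφ hc).ae_hasDerivAt_integral] with x hx hxm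
  have h1 := hx (by rw [uIcc_of_le hab.le]; exact Ioo_subset_Icc_self hxm) a left_mem_uIcc
  refine (h1.const_add (φ a)).congr_of_eventuallyEq ?_
  filter_upwards [Ioo_mem_nhds hxm.1 hxm.2] with y hy
  rw [integral_rightDeriv hab hφ hc (left_mem_Icc.2 hab.le) (Ioo_subset_Icc_self hy)]
  ring

end Convex

/-- A function whose increments are dominated by `(w - v) (T w - T v)`, with `T` arbitrary, is
nonincreasing. -/
lemma antitone_of_sub_le_mul {F T : ℝ → ℝ}
    (h : ∀ v w, v ≤ w → F w - F v ≤ (w - v) * (T w - T v)) : Antitone F := by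
  -- Bisection: on the two halves the length factor is halved while the increments of `T` add up, so
  -- every bisection gains a factor `1 / 2`.
  have key : ∀ n : ℕ, ∀ v w, v ≤ w → F w - F v ≤ (1 / 2) ^ n * ((w - v) * (T w - T v)) := by
    intro n
    induction n with
    | zero => intro v w hvw; simpa using h v w hvw
    | succ n ih =>
      intro v w hvw
      have h1 := ih v ((v + w) / 2) (by linarith)
      have h2 := ih ((v + w) / 2) w (by linarith)
      rw [pow_succ]
      nlinarith
  intro v w hvw
  have hlim : Tendsto (fun n : ℕ => (1 / 2 : ℝ) ^ n * ((w - v) * (T w - T v))) atTop (𝓝 0) := by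
    simpa using (tendsto_pow_atTop_nhds_zero_of_lt_one (by norm_num : (0 : ℝ) ≤ 1 / 2)
      (by norm_num)).mul_const ((w - v) * (T w - T v))
  exact sub_nonpos.1 (ge_of_tendsto' hlim fun n => key n v w hvw)

/-! ### Entropy fluxes -/

section Flux

variable {G φ : ℝ → ℝ} {b : ℝ} {C : ℝ≥0}

lemma intervalIntegrable_deriv_of_lipschitzOnWith (hG : LipschitzOnWith C G (Icc 0 b))
    {x y : ℝ} (hx : x ∈ Icc 0 b) (hy : y ∈ Icc 0 b) : IntervalIntegrable (deriv G) volume x y :=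
  (hG.mono (uIcc_subset_Icc hx hy)).absolutelyContinuousOnInterval.intervalIntegrable_deriv

lemma integral_deriv_of_lipschitzOnWith (hG : LipschitzOnWith C G (Icc 0 b))
    {x y : ℝ} (hx : x ∈ Icc 0 b) (hy : y ∈ Icc 0 b) : ∫ w in x..y, deriv G w = G y - G x :=
  (hG.mono (uIcc_subset_Icc hx hy)).absolutelyContinuousOnInterval.integral_deriv_eq_sub

lemma abs_deriv_le_of_lipschitzOnWith (hG : LipschitzOnWith C G (Icc 0 b)) {x : ℝ}
    (hx : x ∈ Ioo 0 b) : |deriv G x| ≤ C :=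
  norm_deriv_le_of_lipschitzOn (Icc_mem_nhds hx.1 hx.2) hG

lemma intervalIntegrable_mul_deriv (hb : 0 < b) (hG : LipschitzOnWith C G (Icc 0 b)) {q : ℝ → ℝ}
    (hq : IntervalIntegrable q volume 0 b) :
    IntervalIntegrable (fun w => q w * deriv G w) volume 0 b := by
  rw [intervalIntegrable_iff_integrableOn_Ioo_of_le hb.le] at hq ⊢
  refine Integrable.mul_bdd (c := C) hq ?_ ?_
  · exact (measurable_deriv G).aestronglyMeasurable
  · filter_upwards [ae_restrict_mem measurableSet_Ioo] with x hx
    exact abs_deriv_le_of_lipschitzOnWith hG hx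

lemma entropyFlux_eq (hb : 0 < b) (hφ : ConvexOn ℝ (Icc 0 b) φ) (hc : ContinuousOn φ (Icc 0 b))
    {u : ℝ} (hu : u ∈ Icc 0 b) :
    entropyFlux G φ u = ∫ w in (0 : ℝ)..u, derivWithin φ (Ioi w) w * deriv G w := by
  refine intervalIntegral.integral_congr_ae ?_
  filter_upwards [ae_hasDerivAt_rightDeriv hb hφ hc, compl_mem_ae_iff.2 (measure_singleton b)]
    with w hw hwb hwu
  rw [uIoc_of_le hu.1] at hwu
  rw [(hw ⟨hwu.1, lt_of_le_of_ne (hwu.2.trans hu.2) hwb⟩).deriv]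

lemma continuousOn_entropyFlux (hb : 0 < b) (hG : LipschitzOnWith C G (Icc 0 b))
    (hφ : ConvexOn ℝ (Icc 0 b) φ) (hc : ContinuousOn φ (Icc 0 b)) :
    ContinuousOn (entropyFlux G φ) (Icc 0 b) := by
  have hint := intervalIntegrable_mul_deriv hb hG (intervalIntegrable_rightDeriv hb hφ hc)
  have h := intervalIntegral.continuousOn_primitive_interval' hint left_mem_uIcc
  rw [uIcc_of_le hb.le] at h
  exact h.congr fun u hu => entropyFlux_eq hb hφ hc hu

/-- The tail integral of `G' - v` over `[c, y]` is `(G y - v y) - (G c - v c)`, so minimality at `y`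
is exactly the tail condition for monotone weights. Minimality at the left end plays this role for
antitone weights. -/
lemma integral_weight_mul_deriv_le_of_minimizer_right (hb : 0 < b)
    (hG : LipschitzOnWith C G (Icc 0 b)) {q : ℝ → ℝ} {x y v : ℝ} (hx : 0 ≤ x) (hxy : x ≤ y)
    (hy : y ≤ b) (hqi : IntervalIntegrable q volume 0 b) (hq : MonotoneOn q (Ioo 0 b))
    (hq0 : ∀ w, 0 ≤ q w) (hmin : ∀ z ∈ Icc x y, G y - v * y ≤ G z - v * z) :
    ∫ w in x..y, q w * deriv G w ≤ v * ∫ w in x..y, q w := by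
  have hsub : uIcc x y ⊆ uIcc 0 b := by
    rw [uIcc_of_le hxy, uIcc_of_le hb.le]; exact Icc_subset_Icc hx hy
  have hGi : IntervalIntegrable (deriv G) volume x y :=
    intervalIntegrable_deriv_of_lipschitzOnWith hG ⟨hx, hxy.trans hy⟩ ⟨hx.trans hxy, hy⟩
  have h := integral_mul_nonpos_of_monotoneOn (g := fun w => deriv G w - v) hxy
    (hq.mono (Ioo_subset_Ioo hx hy)) hq0 (hGi.sub intervalIntegrable_const) ?_
  · simp only [mul_sub] at h
    rw [intervalIntegral.integral_sub ((intervalIntegrable_mul_deriv hb hG hqi).mono_set hsub)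
      ((hqi.mono_set hsub).mul_const v), intervalIntegral.integral_mul_const] at h
    linarith
  · intro c hc
    have hc' : c ∈ Icc 0 b := ⟨hx.trans hc.1, hc.2.trans hy⟩
    have hy' : y ∈ Icc 0 b := ⟨hx.trans hxy, hy⟩
    rw [intervalIntegral.integral_sub (intervalIntegrable_deriv_of_lipschitzOnWith hG hc' hy')
      intervalIntegrable_const, integral_deriv_of_lipschitzOnWith hG hc' hy',
      intervalIntegral.integral_const, smul_eq_mul]
    linarith [hmin c hc]

lemma integral_weight_mul_deriv_ge_of_minimizer_left (hb : 0 < b)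
    (hG : LipschitzOnWith C G (Icc 0 b)) {q : ℝ → ℝ} {x y v : ℝ} (hx : 0 ≤ x) (hxy : x ≤ y)
    (hy : y ≤ b) (hqi : IntervalIntegrable q volume 0 b) (hq : AntitoneOn q (Ioo 0 b))
    (hq0 : ∀ w, 0 ≤ q w) (hmin : ∀ z ∈ Icc x y, G x - v * x ≤ G z - v * z) :
    v * ∫ w in x..y, q w ≤ ∫ w in x..y, q w * deriv G w := by
  have hsub : uIcc x y ⊆ uIcc 0 b := by
    rw [uIcc_of_le hxy, uIcc_of_le hb.le]; exact Icc_subset_Icc hx hy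
  have hGi : IntervalIntegrable (deriv G) volume x y :=
    intervalIntegrable_deriv_of_lipschitzOnWith hG ⟨hx, hxy.trans hy⟩ ⟨hx.trans hxy, hy⟩
  have h := integral_mul_nonneg_of_antitoneOn (g := fun w => deriv G w - v) hxy
    (hq.mono (Ioo_subset_Ioo hx hy)) hq0 (hGi.sub intervalIntegrable_const) ?_
  · simp only [mul_sub] at h
    rw [intervalIntegral.integral_sub ((intervalIntegrable_mul_deriv hb hG hqi).mono_set hsub)
      ((hqi.mono_set hsub).mul_const v), intervalIntegral.integral_mul_const] at h
    linarith
  · intro c hc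
    have hc' : c ∈ Icc 0 b := ⟨hx.trans hc.1, hc.2.trans hy⟩
    have hx' : x ∈ Icc 0 b := ⟨hx, hxy.trans hy⟩
    rw [intervalIntegral.integral_sub (intervalIntegrable_deriv_of_lipschitzOnWith hG hx' hc')
      intervalIntegrable_const, integral_deriv_of_lipschitzOnWith hG hx' hc',
      intervalIntegral.integral_const, smul_eq_mul]
    linarith [hmin c hc]

/-- If `x` minimizes `G - v ·` and `y` minimizes `G - w ·` on `[x, y]`, then the entropy flux
increment is controlled by the increment of `w φ`, up to a second order term. -/
lemma entropyFlux_sub_le (hb : 0 < b) (hG : LipschitzOnWith C G (Icc 0 b))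
    (hφ : ConvexOn ℝ (Icc 0 b) φ) (hc : ContinuousOn φ (Icc 0 b)) {x y v w : ℝ} (hvw : v ≤ w)
    (hx : 0 ≤ x) (hxy : x ≤ y) (hy : y ≤ b)
    (hminx : ∀ z ∈ Icc x y, G x - v * x ≤ G z - v * z)
    (hminy : ∀ z ∈ Icc x y, G y - w * y ≤ G z - w * z) {z : ℝ} (hz : z ∈ Icc x y) :
    (entropyFlux G φ y - w * φ y) - (entropyFlux G φ x - v * φ x) + (w - v) * φ z ≤
      (w - v) * ∫ z in x..y, |derivWithin φ (Ioi z) z| := by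
  set r : ℝ → ℝ := fun x => derivWithin φ (Ioi x) x with hr
  have hri : IntervalIntegrable r volume 0 b := intervalIntegrable_rightDeriv hb hφ hc
  have hmono : MonotoneOn r (Ioo 0 b) := by
    have := hφ.monotoneOn_rightDeriv
    rwa [interior_Icc] at this
  have hx' : x ∈ Icc 0 b := ⟨hx, hxy.trans hy⟩
  have hy' : y ∈ Icc 0 b := ⟨hx.trans hxy, hy⟩
  have hz' : z ∈ Icc 0 b := ⟨hx.trans hz.1, hz.2.trans hy⟩
  have hposi : IntervalIntegrable (fun z => max (r z) 0) volume 0 b :=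
    ⟨hri.1.pos_part, hri.2.pos_part⟩
  have hnegi : IntervalIntegrable (fun z => max (-r z) 0) volume 0 b :=
    ⟨hri.1.neg_part, hri.2.neg_part⟩
  have hsub : ∀ {c d : ℝ}, c ∈ Icc 0 b → d ∈ Icc 0 b → uIcc c d ⊆ uIcc 0 b := by
    intro c d hc hd
    rw [uIcc_of_le hb.le]; exact uIcc_subset_Icc hc hd
  have hsplit : ∀ z, r z = max (r z) 0 - max (-r z) 0 := fun z =>
    (max_zero_sub_max_neg_zero_eq_self (r z)).symm
  -- The positive part of `φ'` is nondecreasing and is paired with minimality at `y` for the slope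
  -- `w`; the negative part is nonincreasing and is paired with minimality at `x` for the slope `v`.
  have h1 := integral_weight_mul_deriv_le_of_minimizer_right hb hG hx hxy hy hposi
    (fun c hc d hd hcd => max_le_max_right 0 (hmono hc hd hcd)) (fun _ => le_max_right _ _) hminy
  have h2 := integral_weight_mul_deriv_ge_of_minimizer_left hb hG hx hxy hy hnegi
    (fun c hc d hd hcd => max_le_max_right 0 (neg_le_neg (hmono hc hd hcd)))
    (fun _ => le_max_right _ _) hminx
  set P := ∫ z in x..y, max (r z) 0
  set N := ∫ z in x..y, max (-r z) 0
  have hψ : entropyFlux G φ y - entropyFlux G φ x =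
      (∫ z in x..y, max (r z) 0 * deriv G z) - ∫ z in x..y, max (-r z) 0 * deriv G z := by
    have h0 : (0 : ℝ) ∈ Icc 0 b := ⟨le_rfl, hb.le⟩
    have hrG := intervalIntegrable_mul_deriv hb hG hri
    rw [entropyFlux_eq hb hφ hc hx', entropyFlux_eq hb hφ hc hy',
      intervalIntegral.integral_interval_sub_left (hrG.mono_set (hsub h0 hy'))
        (hrG.mono_set (hsub h0 hx')),
      ← intervalIntegral.integral_sub
        ((intervalIntegrable_mul_deriv hb hG hposi).mono_set (hsub hx' hy'))
        ((intervalIntegrable_mul_deriv hb hG hnegi).mono_set (hsub hx' hy'))]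
    simp only [← sub_mul, ← hsplit]
  have hφd : φ y - φ x = P - N := by
    rw [← integral_rightDeriv hb hφ hc hx' hy', ← intervalIntegral.integral_sub
      (hposi.mono_set (hsub hx' hy')) (hnegi.mono_set (hsub hx' hy'))]
    simp only [← hsplit]
    rfl
  have habs : ∫ z in x..y, |r z| = P + N := by
    rw [← intervalIntegral.integral_add
      (hposi.mono_set (hsub hx' hy')) (hnegi.mono_set (hsub hx' hy'))]
    simp only [max_zero_add_max_neg_zero_eq_abs_self]
  have hzx : φ z - φ x ≤ P := by
    rw [← integral_rightDeriv hb hφ hc hx' hz']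
    calc ∫ w in x..z, r w ≤ ∫ w in x..z, max (r w) 0 :=
          intervalIntegral.integral_mono_on hz.1 (hri.mono_set (hsub hx' hz'))
            (hposi.mono_set (hsub hx' hz')) fun w _ => le_max_left _ _
      _ ≤ P := intervalIntegral.integral_mono_interval le_rfl hz.1 hz.2
          (Eventually.of_forall fun w => le_max_right _ _) (hposi.mono_set (hsub hx' hy'))
  rw [habs]
  have h3 := mul_le_mul_of_nonneg_left hzx (sub_nonneg.2 hvw)
  have h4 : w * (φ y - φ x) = w * (P - N) := by rw [hφd]
  linarith

end Flux

/-! ### Monotone selections of minimizers -/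

/-- `k v` minimizes `G - v ·` over `[lam, rho]` for every slope `v`. -/
structure IsArgmin (G : ℝ → ℝ) (lam rho : ℝ) (k : ℝ → ℝ) : Prop where
  mem : ∀ v, k v ∈ Icc lam rho
  le : ∀ v, ∀ y ∈ Icc lam rho, G (k v) - v * k v ≤ G y - v * y

section Argmin

variable {G φ k : ℝ → ℝ} {lam rho b : ℝ} {C : ℝ≥0}

lemma IsArgmin.monotone (hk : IsArgmin G lam rho k) : Monotone k := by
  intro v w hvw
  rcases hvw.eq_or_lt with rfl | hvw
  · rfl
  by_contra h
  have h1 := hk.le v (k w) (hk.mem w)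
  have h2 := hk.le w (k v) (hk.mem v)
  nlinarith [mul_pos (sub_pos.2 hvw) (sub_pos.2 (not_le.1 h))]

lemma measurable_comp_of_continuousOn {X : Type*} [MeasurableSpace X] {f : X → ℝ} (hb : 0 ≤ b)
    (hc : ContinuousOn φ (Icc 0 b)) (hf : Measurable f) (hmem : ∀ x, f x ∈ Icc 0 b) :
    Measurable fun x => φ (f x) := by
  have h1 : Continuous (IccExtend hb ((Icc 0 b).domRestrict φ)) :=
    (continuousOn_iff_continuous_domRestrict.1 hc).Icc_extend'
  convert! h1.measurable.comp hf using 2 with x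
  simp only [Function.comp_apply, IccExtend_of_mem hb _ (hmem x)]
  rfl

lemma locallyIntegrable_of_bounded {f : ℝ → ℝ} {M : ℝ} (hf : Measurable f) (hM : ∀ x, |f x| ≤ M) :
    LocallyIntegrable f :=
  (locallyIntegrable_const M).mono hf.aestronglyMeasurable <| Eventually.of_forall fun x =>
    (hM x).trans (le_abs_self M)

lemma intervalIntegrable_of_bounded {f : ℝ → ℝ} {M : ℝ} (hf : Measurable f) (hM : ∀ x, |f x| ≤ M)
    (x y : ℝ) : IntervalIntegrable f volume x y :=
  intervalIntegrable_iff.2 (((locallyIntegrable_of_bounded hf hM).integrableOn_isCompact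
    isCompact_uIcc).mono_set uIoc_subset_uIcc)

/-- The primitive which encodes the entropy inequality of `k (x / t)` is nonincreasing. -/
lemma IsArgmin.antitone_primitive (hk : IsArgmin G lam rho k) (hb : 0 < b)
    (hG : LipschitzOnWith C G (Icc 0 b)) (hφ : ConvexOn ℝ (Icc 0 b) φ)
    (hc : ContinuousOn φ (Icc 0 b)) (hlam : 0 ≤ lam) (hrho : rho ≤ b) :
    Antitone fun v => entropyFlux G φ (k v) - v * φ (k v) + ∫ s in (0 : ℝ)..v, φ (k s) := by
  have hkb : ∀ v, k v ∈ Icc 0 b := fun v => ⟨hlam.trans (hk.mem v).1, (hk.mem v).2.trans hrho⟩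
  obtain ⟨M, hM⟩ := isCompact_Icc.exists_bound_of_continuousOn hc
  have hint : ∀ x y, IntervalIntegrable (fun s => φ (k s)) volume x y :=
    intervalIntegrable_of_bounded
      (measurable_comp_of_continuousOn hb.le hc hk.monotone.measurable hkb) fun s => hM _ (hkb s)
  have hri := (intervalIntegrable_rightDeriv hb hφ hc).abs
  -- `T v` is the variation of `φ` up to `k v`, so its increment is the integral of `|φ'|` in the
  -- second order error.
  refine antitone_of_sub_le_mul
    (T := fun v => ∫ z in (0 : ℝ)..k v, |derivWithin φ (Ioi z) z|) fun v w hvw => ?_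
  have hkvw := hk.monotone hvw
  have hsub : ∀ {d : ℝ}, d ∈ Icc 0 b → uIcc 0 d ⊆ uIcc 0 b := by
    intro d hd
    rw [uIcc_of_le hb.le]; exact uIcc_subset_Icc ⟨le_rfl, hb.le⟩ hd
  rw [intervalIntegral.integral_interval_sub_left (hri.mono_set (hsub (hkb w)))
    (hri.mono_set (hsub (hkb v)))]
  set V := ∫ z in k v..k w, |derivWithin φ (Ioi z) z|
  set e := (entropyFlux G φ (k w) - w * φ (k w)) - (entropyFlux G φ (k v) - v * φ (k v)) with he
  have hpt : ∀ s ∈ Icc v w, e + (w - v) * φ (k s) ≤ (w - v) * V := fun s hs =>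
    entropyFlux_sub_le hb hG hφ hc hvw (hkb v).1 hkvw (hkb w).2
      (fun z hz => hk.le v z ⟨(hk.mem v).1.trans hz.1, hz.2.trans (hk.mem w).2⟩)
      (fun z hz => hk.le w z ⟨(hk.mem v).1.trans hz.1, hz.2.trans (hk.mem w).2⟩)
      ⟨hk.monotone hs.1, hk.monotone hs.2⟩
  have hΦ : (∫ s in (0 : ℝ)..w, φ (k s)) - ∫ s in (0 : ℝ)..v, φ (k s) = ∫ s in v..w, φ (k s) :=
    intervalIntegral.integral_interval_sub_left (hint _ _) (hint _ _)
  rcases hvw.eq_or_lt with rfl | hlt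
  · simp
  -- The pointwise bound holds with `φ (k s)` for every `s` in `[v, w]`; averaging over `s` produces
  -- the increment of the primitive of `φ ∘ k`.
  have hle : ∫ s in v..w, φ (k s) ≤ ∫ _ in v..w, (V - e / (w - v)) := by
    refine intervalIntegral.integral_mono_on hvw (hint _ _) intervalIntegrable_const fun s hs => ?_
    have hpos := sub_pos.2 hlt
    rw [le_sub_iff_add_le, ← mul_le_mul_iff_right₀ hpos]
    have : (w - v) * (e / (w - v)) = e := by field_simp
    linarith [hpt s hs]
  rw [intervalIntegral.integral_const, smul_eq_mul, mul_sub] at hle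
  have : (w - v) * (e / (w - v)) = e := by field_simp [(sub_pos.2 hlt).ne']
  linarith

end Argmin

/-! ### The one-dimensional entropy inequality in the similarity variable -/

/-- A nonincreasing function has a nonpositive distributional derivative. -/
lemma integral_mul_deriv_nonneg_of_antitone {F Θ : ℝ → ℝ} (hF : Antitone F)
    (hFi : LocallyIntegrable F) (hΘ : ContDiff ℝ 1 Θ) (hc : HasCompactSupport Θ)
    (h0 : ∀ x, 0 ≤ Θ x) : 0 ≤ ∫ v, F v * deriv Θ v := by
  -- Convolving with the reflection of `Θ ≥ 0` preserves monotonicity and is differentiable; the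
  -- derivative at `0` is minus the integral in question.
  set g : ℝ → ℝ := fun x => Θ (-x) with hg
  have hgc : HasCompactSupport g := hc.comp_homeomorph (Homeomorph.neg ℝ)
  have hgd : ContDiff ℝ 1 g := hΘ.comp contDiff_neg
  have hder := hgc.hasDerivAt_convolution_right (ContinuousLinearMap.mul ℝ ℝ) hFi hgd 0
  have hanti : Antitone (convolution F g (ContinuousLinearMap.mul ℝ ℝ) volume) := by
    have hrep : ∀ x, convolution F g (ContinuousLinearMap.mul ℝ ℝ) volume x =
        ∫ t, F (x - t) * g t := by
      intro x
      rw [convolution_eq_swap]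
      rfl
    intro x y hxy
    rw [hrep, hrep]
    have hi : ∀ x, Integrable fun t => F (x - t) * g t := by
      intro x
      have hmono : Monotone fun t => F (x - t) := fun s t hst => hF (by linarith)
      have := (hmono.locallyIntegrable (μ := volume)).integrable_smul_left_of_hasCompactSupport hgd.continuous hgc
      simpa only [smul_eq_mul, mul_comm] using this
    refine integral_mono (hi y) (hi x) fun t => ?_
    exact mul_le_mul_of_nonneg_right (hF (by linarith)) (h0 _)
  have h1 : deriv (convolution F g (ContinuousLinearMap.mul ℝ ℝ) volume) 0 ≤ 0 :=
    hanti.deriv_nonpos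
  rw [hder.deriv, convolution_def] at h1
  have h2 : ∀ t, (ContinuousLinearMap.mul ℝ ℝ) (F t) (deriv g (0 - t)) = -(F t * deriv Θ t) := by
    intro t
    have : deriv g (0 - t) = - deriv Θ t := by
      rw [hg, deriv_comp_neg]
      simp
    rw [this, map_neg, ContinuousLinearMap.mul_apply']
  simp only [h2, integral_neg] at h1
  linarith

/-- Integration by parts. As `f` is only bounded and measurable, its primitive is treated as an
absolutely continuous function, differentiable almost everywhere. -/
lemma integral_primitive_mul_deriv {f Θ : ℝ → ℝ} {M : ℝ} (hf : Measurable f)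
    (hM : ∀ x, |f x| ≤ M) (hΘ : ContDiff ℝ 1 Θ) (hc : HasCompactSupport Θ) :
    ∫ v, (∫ s in (0 : ℝ)..v, f s) * deriv Θ v = -∫ v, f v * Θ v := by
  have hfi := intervalIntegrable_of_bounded hf hM
  obtain ⟨N, hN, hsupp⟩ : ∃ N : ℝ, 0 < N ∧ tsupport Θ ⊆ Ioo (-N) N := by
    obtain ⟨N, hN, h⟩ := hc.isBounded.subset_ball_lt 0 0
    exact ⟨N, hN, by rwa [Real.ball_eq_Ioo, zero_sub, zero_add] at h⟩
  have hNN : -N ≤ N := by linarith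
  have hIoc : Ioo (-N) N ⊆ Ioc (-N) N := Ioo_subset_Ioc_self
  have hz : ∀ x, x ∉ Ioo (-N) N → Θ x = 0 := fun x hx =>
    image_eq_zero_of_notMem_tsupport fun h => hx (hsupp h)
  have hΦ : AbsolutelyContinuousOnInterval (fun v => ∫ s in (0 : ℝ)..v, f s) (-N) N :=
    (hfi (-N) N).absolutelyContinuousOnInterval_intervalIntegral
      (by rw [uIcc_of_le hNN]; exact ⟨by linarith, hN.le⟩)
  have hΘac : AbsolutelyContinuousOnInterval Θ (-N) N :=
    hΘ.contDiffOn.absolutelyContinuousOnInterval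
  have h := hΦ.integral_mul_deriv_eq_deriv_mul hΘac
  rw [hz N (by simp), hz (-N) (by simp)] at h
  have h1 : ∫ v in -N..N, (∫ s in (0 : ℝ)..v, f s) * deriv Θ v =
      ∫ v, (∫ s in (0 : ℝ)..v, f s) * deriv Θ v := by
    refine intervalIntegral.integral_eq_integral_of_support_subset fun x hx => hIoc (hsupp ?_)
    exact support_deriv_subset (right_ne_zero_of_mul hx)
  have h2 : ∫ v in -N..N, deriv (fun v => ∫ s in (0 : ℝ)..v, f s) v * Θ v = ∫ v, f v * Θ v := by
    rw [intervalIntegral.integral_eq_integral_of_support_subset fun x hx => hIoc (hsupp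
      (subset_tsupport _ (right_ne_zero_of_mul hx)))]
    refine integral_congr_ae ?_
    filter_upwards [_root_.LocallyIntegrable.ae_hasDerivAt_integral (locallyIntegrable_of_bounded hf hM)] with x hx
    rw [(hx 0).deriv]
  rw [← h1, h, h2]
  ring

section Argmin

variable {G φ k : ℝ → ℝ} {lam rho b : ℝ} {C : ℝ≥0}

/-- The monotonicity of the primitive in weak form, with the term containing the integral of `φ ∘ k`
integrated by parts. -/
lemma IsArgmin.integral_similarity_le (hk : IsArgmin G lam rho k) (hb : 0 < b)
    (hG : LipschitzOnWith C G (Icc 0 b)) (hφ : ConvexOn ℝ (Icc 0 b) φ)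
    (hc : ContinuousOn φ (Icc 0 b)) (hlam : 0 ≤ lam) (hrho : rho ≤ b) {Θ : ℝ → ℝ}
    (hΘ : ContDiff ℝ 1 Θ) (hΘc : HasCompactSupport Θ) (h0 : ∀ x, 0 ≤ Θ x) :
    ∫ v, φ (k v) * Θ v ≤ ∫ v, (entropyFlux G φ (k v) - v * φ (k v)) * deriv Θ v := by
  have hkb : ∀ v, k v ∈ Icc 0 b := fun v => ⟨hlam.trans (hk.mem v).1, (hk.mem v).2.trans hrho⟩
  obtain ⟨M, hM⟩ := isCompact_Icc.exists_bound_of_continuousOn hc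
  have hm := measurable_comp_of_continuousOn hb.le hc hk.monotone.measurable hkb
  have hanti := hk.antitone_primitive hb hG hφ hc hlam hrho
  have hΦc : Continuous fun v => ∫ s in (0 : ℝ)..v, φ (k s) :=
    intervalIntegral.continuous_primitive (intervalIntegrable_of_bounded hm fun s => hM _ (hkb s)) 0
  have hdc : HasCompactSupport (deriv Θ) := hΘc.deriv
  have hdcont : Continuous (deriv Θ) := hΘ.continuous_deriv le_rfl
  have h1 := integral_mul_deriv_nonneg_of_antitone hanti hanti.locallyIntegrable hΘ hΘc h0
  have hi1 : Integrable fun v => (entropyFlux G φ (k v) - v * φ (k v) +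
      ∫ s in (0 : ℝ)..v, φ (k s)) * deriv Θ v :=
    by
      have := (hanti.locallyIntegrable (μ := volume)).integrable_smul_left_of_hasCompactSupport hdcont hdc
      simpa only [smul_eq_mul, mul_comm] using this
  have hi2 : Integrable fun v => (∫ s in (0 : ℝ)..v, φ (k s)) * deriv Θ v :=
    (hΦc.mul hdcont).integrable_of_hasCompactSupport hdc.mul_left
  have h2 := integral_primitive_mul_deriv hm (fun s => hM _ (hkb s)) hΘ hΘc
  have h3 := integral_sub hi1 hi2
  simp only [← sub_mul, add_sub_cancel_right] at h3
  rw [h3, h2]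
  linarith

end Argmin

/-! ### Test functions on the half-plane -/

section TestFunction

variable {θ : ℝ × ℝ → ℝ}

lemma IsTestFunction.exists_bound (hθ : IsTestFunction θ) :
    ∃ τ M : ℝ, 0 < τ ∧ 0 < M ∧ ∀ p ∈ tsupport θ, τ ≤ p.2 ∧ p.2 ≤ M ∧ |p.1| ≤ M := by
  obtain ⟨M, hM, hMs⟩ := hθ.compact.isBounded.subset_ball_lt 0 0
  have hτ : ∃ τ : ℝ, 0 < τ ∧ ∀ p ∈ tsupport θ, τ ≤ p.2 := by
    rcases (tsupport θ).eq_empty_or_nonempty with h | h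
    · exact ⟨1, one_pos, by simp [h]⟩
    · obtain ⟨p, hp, hmin⟩ := hθ.compact.isCompact.exists_isMinOn h continuous_snd.continuousOn
      exact ⟨p.2, (hθ.support hp).2, fun q hq => hmin hq⟩
  obtain ⟨τ, hτ, hτs⟩ := hτ
  refine ⟨τ, M, hτ, hM, fun p hp => ⟨hτs p hp, ?_, ?_⟩⟩
  · have := mem_ball_zero_iff.1 (hMs hp)
    exact (le_abs_self _).trans ((norm_snd_le p).trans this.le)
  · have := mem_ball_zero_iff.1 (hMs hp)
    exact (norm_fst_le p).trans this.le

lemma IsTestFunction.hasFDerivAt (hθ : IsTestFunction θ) (p : ℝ × ℝ) :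
    HasFDerivAt θ (fderiv ℝ θ p) p :=
  (hθ.smooth.differentiable (by simp) p).hasFDerivAt

lemma IsTestFunction.continuous_fderiv_apply (hθ : IsTestFunction θ) (e : ℝ × ℝ) :
    Continuous fun p => fderiv ℝ θ p e :=
  (hθ.smooth.continuous_fderiv (by simp)).clm_apply continuous_const

lemma IsTestFunction.hasCompactSupport_fderiv_apply (hθ : IsTestFunction θ) (e : ℝ × ℝ) :
    HasCompactSupport fun p => fderiv ℝ θ p e :=
  hθ.compact.fderiv_apply ℝ e

lemma integrable_bounded_mul {X : Type*} [MeasurableSpace X] {μ : Measure X} {f g : X → ℝ} {M : ℝ}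
    (hf : AEStronglyMeasurable f μ) (hM : ∀ x, |f x| ≤ M) (hg : Integrable g μ) :
    Integrable (fun x => f x * g x) μ :=
  hg.bdd_mul hf (Eventually.of_forall hM)

lemma measurableSet_halfPlane : MeasurableSet halfPlane := MeasurableSet.univ.prod measurableSet_Ioi

lemma volume_restrict_halfPlane :
    (volume : Measure (ℝ × ℝ)).restrict halfPlane =
      (volume : Measure ℝ).prod ((volume : Measure ℝ).restrict (Ioi 0)) := by
  rw [halfPlane, Measure.volume_eq_prod, ← Measure.prod_restrict, Measure.restrict_univ]

lemma clm_prod_apply (L : ℝ × ℝ →L[ℝ] ℝ) (x y : ℝ) : L (x, y) = x * L (1, 0) + y * L (0, 1) := by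
  have h : (x, y) = x • ((1 : ℝ), (0 : ℝ)) + y • ((0 : ℝ), (1 : ℝ)) := by ext <;> simp
  rw [h, map_add, map_smul, map_smul, smul_eq_mul, smul_eq_mul]

/-- In similarity variables the test function lives in a compact box. -/
lemma IsTestFunction.exists_similarity_box (hθ : IsTestFunction θ) :
    ∃ τ M N : ℝ, 0 < τ ∧ ∀ v t : ℝ, (v * t, t) ∈ tsupport θ → v ∈ Icc (-N) N ∧ t ∈ Icc τ M := by
  obtain ⟨τ, M, hτ, -, h⟩ := hθ.exists_bound
  refine ⟨τ, M, M / τ, hτ, fun v t hvt => ?_⟩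
  obtain ⟨h1, h2, h3⟩ := h _ hvt
  simp only at h1 h2 h3
  refine ⟨abs_le.1 ?_, h1, h2⟩
  rw [le_div_iff₀ hτ]
  rw [abs_mul, abs_of_pos (hτ.trans_le h1)] at h3
  exact (mul_le_mul_of_nonneg_left h1 (abs_nonneg v)).trans h3

lemma fderiv_eq_zero_of_notMem_tsupport {p : ℝ × ℝ} (hp : p ∉ tsupport θ) : fderiv ℝ θ p = 0 :=
  image_eq_zero_of_notMem_tsupport fun h => hp (tsupport_fderiv_subset ℝ h)

/-- The derivative of `t ↦ t θ (v t, t)`. -/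
def similarityDeriv (θ : ℝ × ℝ → ℝ) (v t : ℝ) : ℝ :=
  θ (v * t, t) + t * (fderiv ℝ θ (v * t, t) (0, 1) + v * fderiv ℝ θ (v * t, t) (1, 0))

lemma IsTestFunction.hasDerivAt_time (hθ : IsTestFunction θ) (v t : ℝ) :
    HasDerivAt (fun t => t * θ (v * t, t)) (similarityDeriv θ v t) t := by
  have h1 : HasDerivAt (fun t : ℝ => (v * t, t)) (v, 1) t := by
    simpa using ((hasDerivAt_id t).const_mul v).prodMk (hasDerivAt_id t)
  have h2 := (hasDerivAt_id t).mul (HasFDerivAt.comp_hasDerivAt (f := fun t : ℝ => (v * t, t)) t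
    (hθ.hasFDerivAt (v * t, t)) h1)
  refine h2.congr_deriv ?_
  rw [clm_prod_apply _ v 1, similarityDeriv]
  simp only [id, Function.comp_apply]
  ring

lemma IsTestFunction.hasDerivAt_slope (hθ : IsTestFunction θ) (v t : ℝ) :
    HasDerivAt (fun v => θ (v * t, t)) (t * fderiv ℝ θ (v * t, t) (1, 0)) v := by
  have h1 : HasDerivAt (fun v : ℝ => (v * t, t)) (t, 0) v := by
    simpa using ((hasDerivAt_id v).mul_const t).prodMk (hasDerivAt_const v t)
  refine ((hθ.hasFDerivAt (v * t, t)).comp_hasDerivAt v h1).congr_deriv ?_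
  rw [clm_prod_apply _ t 0]
  ring

lemma IsTestFunction.continuous_similarityDeriv (hθ : IsTestFunction θ) :
    Continuous fun p : ℝ × ℝ => similarityDeriv θ p.1 p.2 := by
  have h0 := hθ.smooth.continuous
  have h1 := hθ.continuous_fderiv_apply (0, 1)
  have h2 := hθ.continuous_fderiv_apply (1, 0)
  have hm : Continuous fun p : ℝ × ℝ => (p.1 * p.2, p.2) := by fun_prop
  exact (h0.comp hm).add (continuous_snd.mul ((h1.comp hm).add (continuous_fst.mul (h2.comp hm))))

lemma similarityDeriv_eq_zero {v t : ℝ} (h : (v * t, t) ∉ tsupport θ) :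
    similarityDeriv θ v t = 0 := by
  simp [similarityDeriv, image_eq_zero_of_notMem_tsupport h, fderiv_eq_zero_of_notMem_tsupport h]

lemma IsTestFunction.hasCompactSupport_similarityDeriv (hθ : IsTestFunction θ) :
    HasCompactSupport fun p : ℝ × ℝ => similarityDeriv θ p.1 p.2 := by
  obtain ⟨τ, M, N, -, h⟩ := hθ.exists_similarity_box
  refine HasCompactSupport.intro (K := Icc (-N) N ×ˢ Icc τ M) (isCompact_Icc.prod isCompact_Icc) ?_
  exact fun p hp => similarityDeriv_eq_zero fun hmem => hp (h _ _ hmem)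

/-- The integrand is the time derivative of a function supported in a compact subset of the positive
times. -/
lemma IsTestFunction.integral_similarityDeriv (hθ : IsTestFunction θ) (v : ℝ) :
    ∫ t in Ioi (0 : ℝ), similarityDeriv θ v t = 0 := by
  obtain ⟨τ, M, N, hτ, h⟩ := hθ.exists_similarity_box
  have hcs : ∀ f : ℝ → ℝ, (∀ t, (v * t, t) ∉ tsupport θ → f t = 0) → HasCompactSupport f :=
    fun f hf => HasCompactSupport.intro (K := Icc τ M) isCompact_Icc fun t ht =>
      hf t fun hmem => ht (h _ _ hmem).2
  have hc1 : Continuous fun t => similarityDeriv θ v t :=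
    hθ.continuous_similarityDeriv.comp (by fun_prop : Continuous fun t : ℝ => (v, t))
  have hc2 : Continuous fun t => t * θ (v * t, t) :=
    continuous_id.mul (hθ.smooth.continuous.comp (by fun_prop))
  rw [setIntegral_eq_integral_of_forall_compl_eq_zero]
  · refine integral_eq_zero_of_hasDerivAt_of_integrable (fun t => hθ.hasDerivAt_time v t) ?_ ?_
    · exact hc1.integrable_of_hasCompactSupport (hcs _ fun t ht => similarityDeriv_eq_zero ht)
    · exact hc2.integrable_of_hasCompactSupport (hcs _ fun t ht => by
        rw [image_eq_zero_of_notMem_tsupport ht, mul_zero])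
  · intro t ht
    exact similarityDeriv_eq_zero fun hmem => ht (hτ.trans_le (h _ _ hmem).2.1)

end TestFunction

/-! ### The entropy inequality for the fan on the half-plane. -/

section Dissipation

variable {G φ k : ℝ → ℝ} {lam rho b : ℝ} {C : ℝ≥0} {θ : ℝ × ℝ → ℝ}

/-- The entropy inequality on a time slice, in similarity variables. -/
lemma IsArgmin.slice_le (hk : IsArgmin G lam rho k) (hb : 0 < b)
    (hG : LipschitzOnWith C G (Icc 0 b)) (hφ : ConvexOn ℝ (Icc 0 b) φ)
    (hc : ContinuousOn φ (Icc 0 b)) (hlam : 0 ≤ lam) (hrho : rho ≤ b) (hθ : IsTestFunction θ)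
    {t : ℝ} (ht : 0 < t) :
    ∫ v, φ (k v) * similarityDeriv θ v t ≤
      ∫ x, (φ (k (x / t)) * fderiv ℝ θ (x, t) (0, 1) +
        entropyFlux G φ (k (x / t)) * fderiv ℝ θ (x, t) (1, 0)) := by
  have hkb : ∀ v, k v ∈ Icc 0 b := fun v => ⟨hlam.trans (hk.mem v).1, (hk.mem v).2.trans hrho⟩
  obtain ⟨τ, M, N, hτ, hbox⟩ := hθ.exists_similarity_box
  have hψc := continuousOn_entropyFlux hb hG hφ hc
  obtain ⟨A, hA⟩ := isCompact_Icc.exists_bound_of_continuousOn hc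
  obtain ⟨B, hB⟩ := isCompact_Icc.exists_bound_of_continuousOn hψc
  have hmφ := measurable_comp_of_continuousOn hb.le hc hk.monotone.measurable hkb
  have hmψ := measurable_comp_of_continuousOn hb.le hψc hk.monotone.measurable hkb
  have hcs : ∀ f : ℝ → ℝ, (∀ v, (v * t, t) ∉ tsupport θ → f v = 0) → HasCompactSupport f :=
    fun f hf => HasCompactSupport.intro (K := Icc (-N) N) isCompact_Icc fun v hv =>
      hf v fun hmem => hv (hbox _ _ hmem).1
  have hline : Continuous fun v : ℝ => (v * t, t) := by fun_prop
  set Θ : ℝ → ℝ := fun v => θ (v * t, t) with hΘ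
  have hΘd : ContDiff ℝ 1 Θ := (hθ.smooth.of_le (by exact_mod_cast le_top)).comp (by fun_prop)
  have hΘc : HasCompactSupport Θ := hcs _ fun v hv =>
    image_eq_zero_of_notMem_tsupport (f := θ) hv
  have hderiv : ∀ v, deriv Θ v = t * fderiv ℝ θ (v * t, t) (1, 0) := fun v =>
    (hθ.hasDerivAt_slope v t).deriv
  have h1 := hk.integral_similarity_le hb hG hφ hc hlam hrho hΘd hΘc fun v => hθ.nonneg _
  set T : ℝ → ℝ := fun v => t * (fderiv ℝ θ (v * t, t) (0, 1) + v * fderiv ℝ θ (v * t, t) (1, 0))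
  have hTc : Continuous T := continuous_const.mul
    (((hθ.continuous_fderiv_apply (0, 1)).comp hline).add
      (continuous_id.mul ((hθ.continuous_fderiv_apply (1, 0)).comp hline)))
  have hTi : Integrable T := hTc.integrable_of_hasCompactSupport (hcs _ fun v hv => by
    simp [T, fderiv_eq_zero_of_notMem_tsupport hv])
  have hdi : Integrable (deriv Θ) :=
    (hΘd.continuous_deriv le_rfl).integrable_of_hasCompactSupport hΘc.deriv
  have hvdi : Integrable fun v => v * deriv Θ v :=
    (continuous_id.mul (hΘd.continuous_deriv le_rfl)).integrable_of_hasCompactSupport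
      hΘc.deriv.mul_left
  have hφT := integrable_bounded_mul hmφ.aestronglyMeasurable (fun v => hA _ (hkb v)) hTi
  have hΘi : Integrable Θ := hΘd.continuous.integrable_of_hasCompactSupport hΘc
  have hφΘ := integrable_bounded_mul hmφ.aestronglyMeasurable (fun v => hA _ (hkb v)) hΘi
  have hψd := integrable_bounded_mul hmψ.aestronglyMeasurable (fun v => hB _ (hkb v)) hdi
  have hφd := integrable_bounded_mul hmφ.aestronglyMeasurable (fun v => hA _ (hkb v)) hvdi
  have hEd : Integrable fun v => (entropyFlux G φ (k v) - v * φ (k v)) * deriv Θ v := by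
    refine (hψd.sub hφd).congr (Eventually.of_forall fun v => ?_)
    simp only [Pi.sub_apply]
    ring
  -- Substituting `x = v t` turns the slice integrand into `φ T + (ψ - v φ) Θ'`, because `Θ' = t
  -- ∂ₓθ`. The inequality in `v` replaces the second term by `φ Θ`, and `Θ + T` is
  -- `similarityDeriv`.
  have h2 := Measure.integral_comp_mul_right (fun x => φ (k (x / t)) * fderiv ℝ θ (x, t) (0, 1) +
        entropyFlux G φ (k (x / t)) * fderiv ℝ θ (x, t) (1, 0)) t
  rw [abs_of_pos (inv_pos.2 ht), smul_eq_mul, eq_inv_mul_iff_mul_eq₀ ht.ne'] at h2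
  rw [← h2, ← integral_const_mul]
  calc ∫ v, φ (k v) * similarityDeriv θ v t
      = (∫ v, φ (k v) * Θ v) + ∫ v, φ (k v) * T v := by
        rw [← integral_add hφΘ hφT]
        simp only [similarityDeriv, mul_add, Θ, T]
    _ ≤ (∫ v, (entropyFlux G φ (k v) - v * φ (k v)) * deriv Θ v) + ∫ v, φ (k v) * T v := by
        linarith
    _ = _ := by
        rw [← integral_add hEd hφT]
        refine integral_congr_ae (Eventually.of_forall fun v => ?_)
        simp only [hderiv, T, mul_div_cancel_right₀ _ ht.ne']
        ring

/-- `k (x / t)` satisfies the entropy inequality. -/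
lemma IsArgmin.dissipative (hk : IsArgmin G lam rho k) (hb : 0 < b)
    (hG : LipschitzOnWith C G (Icc 0 b)) (hφ : ConvexOn ℝ (Icc 0 b) φ)
    (hc : ContinuousOn φ (Icc 0 b)) (hlam : 0 ≤ lam) (hrho : rho ≤ b) (hθ : IsTestFunction θ) :
    0 ≤ ∫ p in halfPlane, (φ (k (p.1 / p.2)) * fderiv ℝ θ p (0, 1) +
      entropyFlux G φ (k (p.1 / p.2)) * fderiv ℝ θ p (1, 0)) := by
  have hkb : ∀ v, k v ∈ Icc 0 b := fun v => ⟨hlam.trans (hk.mem v).1, (hk.mem v).2.trans hrho⟩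
  have hψc := continuousOn_entropyFlux hb hG hφ hc
  obtain ⟨A, hA⟩ := isCompact_Icc.exists_bound_of_continuousOn hc
  obtain ⟨B, hB⟩ := isCompact_Icc.exists_bound_of_continuousOn hψc
  have hkm : Measurable fun p : ℝ × ℝ => k (p.1 / p.2) :=
    hk.monotone.measurable.comp (measurable_fst.div measurable_snd)
  have hmφ := measurable_comp_of_continuousOn hb.le hc hkm fun p => hkb _
  have hmψ := measurable_comp_of_continuousOn hb.le hψc hkm fun p => hkb _
  have hI : Integrable fun p : ℝ × ℝ => φ (k (p.1 / p.2)) * fderiv ℝ θ p (0, 1) +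
      entropyFlux G φ (k (p.1 / p.2)) * fderiv ℝ θ p (1, 0) :=
    (integrable_bounded_mul hmφ.aestronglyMeasurable (fun p => hA _ (hkb _))
      ((hθ.continuous_fderiv_apply _).integrable_of_hasCompactSupport
        (hθ.hasCompactSupport_fderiv_apply _))).add
    (integrable_bounded_mul hmψ.aestronglyMeasurable (fun p => hB _ (hkb _))
      ((hθ.continuous_fderiv_apply _).integrable_of_hasCompactSupport
        (hθ.hasCompactSupport_fderiv_apply _)))
  have hJ : Integrable fun p : ℝ × ℝ => φ (k p.1) * similarityDeriv θ p.1 p.2 :=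
    integrable_bounded_mul (measurable_comp_of_continuousOn hb.le hc
      (hk.monotone.measurable.comp measurable_fst) fun p => hkb _).aestronglyMeasurable
      (fun p => hA _ (hkb _)) (hθ.continuous_similarityDeriv.integrable_of_hasCompactSupport
        hθ.hasCompactSupport_similarityDeriv)
  have hI' := hI.restrict (s := halfPlane)
  have hJ' := hJ.restrict (s := halfPlane)
  rw [volume_restrict_halfPlane] at hI' hJ' ⊢
  rw [integral_prod_symm _ hI']
  -- `φ (k v)` does not depend on `t`, so integrating first in `t` kills the lower bound of the
  -- slices.
  calc (0 : ℝ) = ∫ t in Ioi (0 : ℝ), ∫ v, φ (k v) * similarityDeriv θ v t := by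
        rw [← integral_integral_swap hJ']
        simp only [integral_const_mul, hθ.integral_similarityDeriv, mul_zero, integral_zero]
    _ ≤ _ := by
        refine setIntegral_mono_on hJ'.integral_prod_right hI'.integral_prod_right
          measurableSet_Ioi fun t ht => ?_
        exact hk.slice_le hb hG hφ hc hlam hrho hθ ht

end Dissipation

/-! ### Localization of the entropy inequality to a moving interval -/

lemma expNegInvGlue_le_one (x : ℝ) : expNegInvGlue x ≤ 1 := by
  rcases le_or_gt x 0 with h | h
  · rw [expNegInvGlue.zero_of_nonpos h]; exact zero_le_one
  · rw [expNegInvGlue, if_neg (not_le.2 h), Real.exp_le_one_iff]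
    exact neg_nonpos.2 (inv_nonneg.2 h.le)

lemma hasDerivAt_expNegInvGlue (x : ℝ) : HasDerivAt expNegInvGlue (deriv expNegInvGlue x) x :=
  ((expNegInvGlue.contDiff (n := 1)).differentiable (by simp) x).hasDerivAt

lemma deriv_expNegInvGlue_nonneg (x : ℝ) : 0 ≤ deriv expNegInvGlue x :=
  expNegInvGlue.monotone.deriv_nonneg

lemma deriv_expNegInvGlue_pos {x : ℝ} (hx : 0 < x) : 0 < deriv expNegInvGlue x := by
  have h1 : HasDerivAt (fun y : ℝ => Real.exp (-y⁻¹)) (Real.exp (-x⁻¹) * (-(-(x ^ 2)⁻¹))) x :=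
    ((hasDerivAt_inv hx.ne').neg).exp
  have h2 : expNegInvGlue =ᶠ[𝓝 x] fun y => Real.exp (-y⁻¹) := by
    filter_upwards [Ioi_mem_nhds hx] with y hy
    rw [expNegInvGlue, if_neg (not_le.2 hy)]
  rw [h2.deriv_eq, h1.deriv, neg_neg]
  positivity

section Ramp

/-- A smooth ramp from `0` at `t = ε` to `1` at `t = 2 ε`. -/
def ramp (ε t : ℝ) : ℝ := Real.smoothTransition (t / ε - 1)

variable {ε : ℝ}

lemma contDiff_ramp : ContDiff ℝ ∞ (ramp ε) :=
  Real.smoothTransition.contDiff.comp ((contDiff_id.div_const ε).sub contDiff_const)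

lemma ramp_eq_zero (hε : 0 < ε) {t : ℝ} (ht : t ≤ ε) : ramp ε t = 0 :=
  Real.smoothTransition.zero_of_nonpos (by rw [sub_nonpos, div_le_one hε]; exact ht)

lemma ramp_eq_one (hε : 0 < ε) {t : ℝ} (ht : 2 * ε ≤ t) : ramp ε t = 1 :=
  Real.smoothTransition.one_of_one_le (by rw [le_sub_iff_add_le, le_div_iff₀ hε]; linarith)

lemma ramp_monotone (hε : 0 < ε) : Monotone (ramp ε) := fun x y hxy =>
  Real.smoothTransition.monotone (by gcongr)

lemma hasDerivAt_ramp (t : ℝ) : HasDerivAt (ramp ε) (deriv (ramp ε) t) t :=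
  (contDiff_ramp.differentiable (by simp) t).hasDerivAt

lemma mem_Icc_of_deriv_ramp_ne_zero (hε : 0 < ε) {t : ℝ} (h : deriv (ramp ε) t ≠ 0) :
    t ∈ Icc ε (2 * ε) := by
  constructor
  · by_contra hlt
    refine h (HasDerivAt.deriv ?_)
    refine (hasDerivAt_const t (0 : ℝ)).congr_of_eventuallyEq ?_
    filter_upwards [Iio_mem_nhds (not_le.1 hlt)] with y hy using ramp_eq_zero hε (le_of_lt hy)
  · by_contra hlt
    refine h (HasDerivAt.deriv ?_)
    refine (hasDerivAt_const t (1 : ℝ)).congr_of_eventuallyEq ?_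
    filter_upwards [Ioi_mem_nhds (not_le.1 hlt)] with y hy using ramp_eq_one hε (le_of_lt hy)

lemma tendsto_ramp (hε : 0 < ε) : Tendsto (ramp ε) atTop (𝓝 1) :=
  tendsto_const_nhds.congr' <| by
    filter_upwards [eventually_ge_atTop (2 * ε)] with t ht using (ramp_eq_one hε ht).symm

lemma integrableOn_deriv_ramp (hε : 0 < ε) : IntegrableOn (deriv (ramp ε)) (Ioi 0) :=
  integrableOn_Ioi_deriv_of_nonneg contDiff_ramp.continuous.continuousWithinAt
    (fun t _ => hasDerivAt_ramp t) (fun _ _ => (ramp_monotone hε).deriv_nonneg) (tendsto_ramp hε)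

lemma integral_deriv_ramp (hε : 0 < ε) : ∫ t in Ioi (0 : ℝ), deriv (ramp ε) t = 1 := by
  rw [integral_Ioi_of_hasDerivAt_of_nonneg contDiff_ramp.continuous.continuousWithinAt
    (fun t _ => hasDerivAt_ramp t) (fun _ _ => (ramp_monotone hε).deriv_nonneg) (tendsto_ramp hε),
    ramp_eq_zero hε hε.le, sub_zero]

end Ramp

/-- A smooth weight, positive exactly when `A + r p.2 < p.1 < B + s p.2`. -/
def coneWeight (A B r s : ℝ) (p : ℝ × ℝ) : ℝ :=
  expNegInvGlue (p.1 - r * p.2 - A) * expNegInvGlue (B - (p.1 - s * p.2))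

section ConeWeight

variable {A B r s : ℝ}

lemma contDiff_coneWeight : ContDiff ℝ ∞ (coneWeight A B r s) :=
  (expNegInvGlue.contDiff.comp (by fun_prop)).mul (expNegInvGlue.contDiff.comp (by fun_prop))

lemma coneWeight_nonneg (p : ℝ × ℝ) : 0 ≤ coneWeight A B r s p :=
  mul_nonneg (expNegInvGlue.nonneg _) (expNegInvGlue.nonneg _)

lemma coneWeight_le_one (p : ℝ × ℝ) : coneWeight A B r s p ≤ 1 :=
  mul_le_one₀ (expNegInvGlue_le_one _) (expNegInvGlue.nonneg _) (expNegInvGlue_le_one _)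

lemma coneWeight_pos {p : ℝ × ℝ} (h1 : A + r * p.2 < p.1) (h2 : p.1 < B + s * p.2) :
    0 < coneWeight A B r s p :=
  mul_pos (expNegInvGlue.pos_of_pos (by linarith)) (expNegInvGlue.pos_of_pos (by linarith))

lemma coneWeight_eq_zero {p : ℝ × ℝ} (h : ¬(A + r * p.2 < p.1 ∧ p.1 < B + s * p.2)) :
    coneWeight A B r s p = 0 := by
  rcases not_and_or.1 h with h | h
  · rw [coneWeight, expNegInvGlue.zero_of_nonpos (by linarith), zero_mul]
  · rw [coneWeight, expNegInvGlue.zero_of_nonpos (x := B - (p.1 - s * p.2)) (by linarith), mul_zero]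

lemma abs_le_of_coneWeight_ne_zero {p : ℝ × ℝ} {T : ℝ} (h : coneWeight A B r s p ≠ 0)
    (h0 : 0 ≤ p.2) (hT : p.2 ≤ T) : |p.1| ≤ |A| + |B| + (|r| + |s|) * T := by
  obtain ⟨h1, h2⟩ := not_not.1 (mt coneWeight_eq_zero h)
  have hr : |r * p.2| ≤ |r| * T := by
    rw [abs_mul, abs_of_nonneg h0]; exact mul_le_mul_of_nonneg_left hT (abs_nonneg r)
  have hs : |s * p.2| ≤ |s| * T := by
    rw [abs_mul, abs_of_nonneg h0]; exact mul_le_mul_of_nonneg_left hT (abs_nonneg s)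
  have := abs_le.1 hr
  have := abs_le.1 hs
  have := neg_abs_le A
  have := le_abs_self B
  have := abs_nonneg A
  have := abs_nonneg B
  have := abs_nonneg r
  have := abs_nonneg s
  have hT0 := h0.trans hT
  have := mul_nonneg (abs_nonneg r) hT0
  have := mul_nonneg (abs_nonneg s) hT0
  refine abs_le.2 ⟨by linarith, by linarith⟩

/-- A smooth time cutoff, vanishing for `t ≤ ε` and for `T ≤ t`. -/
def timeWeight (ε T t : ℝ) : ℝ := ramp ε t * expNegInvGlue (T - t)

lemma contDiff_timeWeight (ε T : ℝ) : ContDiff ℝ ∞ (timeWeight ε T) :=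
  contDiff_ramp.mul (expNegInvGlue.contDiff.comp (by fun_prop))

lemma timeWeight_nonneg (ε T t : ℝ) : 0 ≤ timeWeight ε T t :=
  mul_nonneg (Real.smoothTransition.nonneg _) (expNegInvGlue.nonneg _)

lemma mem_Icc_of_ramp_mul_ne_zero {ε T t : ℝ} {g : ℝ → ℝ} (hε : 0 < ε)
    (hg : ∀ y < 0, g y = 0) (h : ramp ε t * g (T - t) ≠ 0) : t ∈ Icc ε T := by
  constructor
  · by_contra hlt
    exact left_ne_zero_of_mul h (ramp_eq_zero hε (not_le.1 hlt).le)
  · by_contra hlt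
    exact right_ne_zero_of_mul h (hg _ (by linarith))

lemma deriv_timeWeight (ε T t : ℝ) : deriv (timeWeight ε T) t =
    deriv (ramp ε) t * expNegInvGlue (T - t) - ramp ε t * deriv expNegInvGlue (T - t) := by
  have h := (hasDerivAt_ramp (ε := ε) t).mul
    ((hasDerivAt_expNegInvGlue (T - t)).comp t ((hasDerivAt_id t).const_sub T))
  refine (h.congr_deriv ?_).deriv
  simp only [Function.comp_apply]
  ring

lemma deriv_expNegInvGlue_eq_zero {y : ℝ} (hy : y < 0) : deriv expNegInvGlue y = 0 := by
  refine ((hasDerivAt_const y (0 : ℝ)).congr_of_eventuallyEq ?_).deriv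
  filter_upwards [Iio_mem_nhds hy] with z hz using expNegInvGlue.zero_of_nonpos (le_of_lt hz)

end ConeWeight

section Localization

variable {A B r s : ℝ}

lemma hasDerivAt_coneWeight_space (x t : ℝ) :
    HasDerivAt (fun x => coneWeight A B r s (x, t))
      (deriv expNegInvGlue (x - r * t - A) * expNegInvGlue (B - (x - s * t)) -
        expNegInvGlue (x - r * t - A) * deriv expNegInvGlue (B - (x - s * t))) x := by
  have h1 : HasDerivAt (fun x : ℝ => x - r * t - A) 1 x :=
    ((hasDerivAt_id x).sub_const _).sub_const _
  have h2 : HasDerivAt (fun x : ℝ => B - (x - s * t)) (-1) x :=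
    ((hasDerivAt_id x).sub_const _).const_sub _
  refine (((hasDerivAt_expNegInvGlue _).comp x h1).mul
    ((hasDerivAt_expNegInvGlue _).comp x h2)).congr_deriv ?_
  simp only [Function.comp_apply]
  ring

lemma hasDerivAt_coneWeight_time (x t : ℝ) :
    HasDerivAt (fun t => coneWeight A B r s (x, t))
      (-r * (deriv expNegInvGlue (x - r * t - A) * expNegInvGlue (B - (x - s * t))) +
        s * (expNegInvGlue (x - r * t - A) * deriv expNegInvGlue (B - (x - s * t)))) t := by
  have h1 : HasDerivAt (fun t : ℝ => x - r * t - A) (-r) t := by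
    simpa using (((hasDerivAt_id t).const_mul r).const_sub x).sub_const A
  have h2 : HasDerivAt (fun t : ℝ => B - (x - s * t)) s t := by
    simpa using (((hasDerivAt_id t).const_mul s).const_sub x).const_sub B
  refine (((hasDerivAt_expNegInvGlue _).comp t h1).mul
    ((hasDerivAt_expNegInvGlue _).comp t h2)).congr_deriv ?_
  simp only [Function.comp_apply]
  ring

lemma fderiv_apply_space {θ : ℝ × ℝ → ℝ} (hθ : Differentiable ℝ θ) {x t d : ℝ}
    (h : HasDerivAt (fun x => θ (x, t)) d x) : fderiv ℝ θ (x, t) (1, 0) = d := by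
  have h1 : HasDerivAt (fun x : ℝ => (x, t)) (1, 0) x :=
    (hasDerivAt_id x).prodMk (hasDerivAt_const x t)
  exact (HasFDerivAt.comp_hasDerivAt (f := fun x : ℝ => (x, t)) x
    (hθ (x, t)).hasFDerivAt h1).unique h

lemma fderiv_apply_time {θ : ℝ × ℝ → ℝ} (hθ : Differentiable ℝ θ) {x t d : ℝ}
    (h : HasDerivAt (fun t => θ (x, t)) d t) : fderiv ℝ θ (x, t) (0, 1) = d := by
  have h1 : HasDerivAt (fun t : ℝ => (x, t)) (0, 1) t :=
    (hasDerivAt_const t x).prodMk (hasDerivAt_id t)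
  exact (HasFDerivAt.comp_hasDerivAt (f := fun t : ℝ => (x, t)) t
    (hθ (x, t)).hasFDerivAt h1).unique h

/-- The product of a time cutoff and the cone weight. -/
def coneTest (a : ℝ → ℝ) (A B r s : ℝ) (p : ℝ × ℝ) : ℝ := a p.2 * coneWeight A B r s p

variable {a : ℝ → ℝ} {ε T : ℝ}

lemma coneTest_box (ha0 : ∀ t, a t ≠ 0 → t ∈ Icc ε T) (hε : 0 < ε) {p : ℝ × ℝ}
    (hp : coneTest a A B r s p ≠ 0) :
    p ∈ Icc (-(|A| + |B| + (|r| + |s|) * T)) (|A| + |B| + (|r| + |s|) * T) ×ˢ Icc ε T := by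
  have h1 := ha0 _ (left_ne_zero_of_mul hp)
  exact ⟨abs_le.1 (abs_le_of_coneWeight_ne_zero (right_ne_zero_of_mul hp) (hε.le.trans h1.1) h1.2),
    h1⟩

lemma hasCompactSupport_coneTest (ha0 : ∀ t, a t ≠ 0 → t ∈ Icc ε T) (hε : 0 < ε) :
    HasCompactSupport (coneTest a A B r s) :=
  HasCompactSupport.intro (isCompact_Icc.prod isCompact_Icc) fun p hp => by
    by_contra h
    exact hp (coneTest_box ha0 hε h)

lemma isTestFunction_coneTest (ha : ContDiff ℝ ∞ a) (ha0 : ∀ t, a t ≠ 0 → t ∈ Icc ε T)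
    (hε : 0 < ε) (hnn : ∀ t, 0 ≤ a t) : IsTestFunction (coneTest a A B r s) where
  smooth := (ha.comp contDiff_snd).mul contDiff_coneWeight
  compact := hasCompactSupport_coneTest ha0 hε
  support := by
    refine (closure_minimal (fun p hp => coneTest_box ha0 hε hp)
      (isClosed_Icc.prod isClosed_Icc)).trans fun p hp => ⟨mem_univ _, hε.trans_le hp.2.1⟩
  nonneg p := mul_nonneg (hnn _) (coneWeight_nonneg _)

end Localization

/-- The space derivative of a test function has zero integral. -/
lemma IsTestFunction.integral_fderiv_space {θ : ℝ × ℝ → ℝ} (hθ : IsTestFunction θ) :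
    ∫ p in halfPlane, fderiv ℝ θ p (1, 0) = 0 := by
  have hint : Integrable fun p => fderiv ℝ θ p (1, 0) :=
    (hθ.continuous_fderiv_apply _).integrable_of_hasCompactSupport
      (hθ.hasCompactSupport_fderiv_apply _)
  obtain ⟨τ, M, hτ, hM, h⟩ := hθ.exists_bound
  have h' := hint.restrict (s := halfPlane)
  rw [volume_restrict_halfPlane] at h' ⊢
  rw [integral_prod_symm _ h']
  refine (integral_congr_ae (Eventually.of_forall fun t => ?_)).trans (integral_zero _ _)
  have hcs : ∀ f : ℝ → ℝ, (∀ x, (x, t) ∉ tsupport θ → f x = 0) → HasCompactSupport f :=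
    fun f hf => HasCompactSupport.intro (K := Icc (-M) M) isCompact_Icc fun x hx =>
      hf x fun hmem => hx (abs_le.1 (h _ hmem).2.2)
  have hline : Continuous fun x : ℝ => (x, t) := by fun_prop
  refine integral_eq_zero_of_hasDerivAt_of_integrable (f := fun x => θ (x, t)) (fun x => ?_) ?_ ?_
  · exact HasFDerivAt.comp_hasDerivAt (f := fun x : ℝ => (x, t)) x (hθ.hasFDerivAt (x, t))
      ((hasDerivAt_id x).prodMk (hasDerivAt_const x t))
  · exact ((hθ.continuous_fderiv_apply _).comp hline).integrable_of_hasCompactSupport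
      (hcs _ fun x hx => by
        simp only [Function.comp_apply, fderiv_eq_zero_of_notMem_tsupport hx]; rfl)
  · exact (hθ.smooth.continuous.comp hline).integrable_of_hasCompactSupport
      (hcs _ fun x hx => image_eq_zero_of_notMem_tsupport (f := θ) hx)

/-- An entropy solution has a globally measurable representative. -/
lemma IsEntropySolution.exists_measurable {K : ℕ} {G : ℝ → ℝ} {w : ℝ → ℝ → ℝ}
    (hw : IsEntropySolution K G w) :
    ∃ W : ℝ × ℝ → ℝ, Measurable W ∧ (∀ p, W p ∈ Icc (0 : ℝ) K) ∧
      ∀ x t, 0 < t → W (x, t) = w x t := by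
  set e : ℝ × Ioi (0 : ℝ) → ℝ × ℝ := Prod.map id Subtype.val with he
  have hemb : MeasurableEmbedding e :=
    MeasurableEmbedding.id.prodMap (MeasurableEmbedding.subtype_coe measurableSet_Ioi)
  -- Only the values at positive times are known to be measurable and in `[0, K]`; elsewhere the
  -- value `0` is used, which lies in `[0, K]`.
  set W := Function.extend e (fun p => w p.1 p.2) 0 with hW
  have hval : ∀ x t, 0 < t → W (x, t) = w x t := fun x t ht =>
    hemb.injective.extend_apply (fun p : ℝ × Ioi (0 : ℝ) => w p.1 p.2) 0 (x, ⟨t, ht⟩)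
  refine ⟨W, hemb.measurable_extend hw.measurable measurable_zero, fun p => ?_, hval⟩
  rcases lt_or_ge 0 p.2 with h | h
  · rw [← Prod.mk.eta (p := p), hval _ _ h]; exact hw.mem_Icc _ _ h
  · have : W p = 0 := Function.extend_apply' _ _ _ (by
      rintro ⟨q, rfl⟩
      exact absurd q.2.2 (not_lt.2 h))
    rw [this]
    exact ⟨le_rfl, Nat.cast_nonneg K⟩

/-! ### Balance of an entropy on an interval with moving ends. -/

section Weighted

variable {K : ℕ} {G φ : ℝ → ℝ} {C : ℝ≥0} {w : ℝ → ℝ → ℝ} {W : ℝ × ℝ → ℝ}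

/-- The entropy inequality tested against a time cutoff times a cone weight. -/
lemma IsEntropySolution.integral_coneWeight_nonneg (hK : (0 : ℝ) < K)
    (hG : LipschitzOnWith C G (Icc (0 : ℝ) K)) (hw : IsEntropySolution K G w)
    (hWm : Measurable W) (hWb : ∀ p, W p ∈ Icc (0 : ℝ) K) (hW : ∀ x t, 0 < t → W (x, t) = w x t)
    (hφ : ConvexOn ℝ (Icc (0 : ℝ) K) φ) (hc : ContinuousOn φ (Icc (0 : ℝ) K)) {c A B r s : ℝ}
    (hQ : ∀ᵐ p ∂((volume : Measure (ℝ × ℝ)).restrict halfPlane),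
      s * φ (W p) ≤ entropyFlux G φ (W p) - c ∧ entropyFlux G φ (W p) - c ≤ r * φ (W p))
    {a : ℝ → ℝ} {ε T : ℝ} (ha : ContDiff ℝ ∞ a) (ha0 : ∀ t, a t ≠ 0 → t ∈ Icc ε T) (hε : 0 < ε)
    (hnn : ∀ t, 0 ≤ a t) :
    0 ≤ ∫ p in halfPlane, φ (W p) * (deriv a p.2 * coneWeight A B r s p) := by
  have hψc := continuousOn_entropyFlux hK hG hφ hc
  obtain ⟨M, hM⟩ := isCompact_Icc.exists_bound_of_continuousOn hc
  obtain ⟨M', hM'⟩ := isCompact_Icc.exists_bound_of_continuousOn hψc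
  have hmφ := measurable_comp_of_continuousOn hK.le hc hWm hWb
  have hmψ := measurable_comp_of_continuousOn hK.le hψc hWm hWb
  have hθ : IsTestFunction (coneTest a A B r s) := isTestFunction_coneTest ha ha0 hε hnn
  set θ := coneTest a A B r s with hθdef
  have hθd : Differentiable ℝ θ := hθ.smooth.differentiable (by simp)
  have hfd : ∀ e, Integrable fun p => fderiv ℝ θ p e := fun e =>
    (hθ.continuous_fderiv_apply e).integrable_of_hasCompactSupport
      (hθ.hasCompactSupport_fderiv_apply e)
  have hφt := (integrable_bounded_mul hmφ.aestronglyMeasurable (fun p => hM _ (hWb p))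
    (hfd (0, 1))).restrict (s := halfPlane)
  have hψx := (integrable_bounded_mul hmψ.aestronglyMeasurable (fun p => hM' _ (hWb p))
    (hfd (1, 0))).restrict (s := halfPlane)
  have hcx := ((hfd (1, 0)).const_mul c).restrict (s := halfPlane)
  have hda : Continuous (deriv a) := ha.continuous_deriv (by simp)
  have hda0 : ∀ t, deriv a t ≠ 0 → t ∈ Icc ε T := fun t ht =>
    closure_minimal (fun t ht => ha0 t ht) isClosed_Icc (support_deriv_subset ht)
  have hR : Integrable (fun p => φ (W p) * (deriv a p.2 * coneWeight A B r s p))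
      ((volume : Measure (ℝ × ℝ)).restrict halfPlane) := by
    refine (integrable_bounded_mul hmφ.aestronglyMeasurable (fun p => hM _ (hWb p))
      (Continuous.integrable_of_hasCompactSupport ?_ ?_)).restrict
    · exact (hda.comp continuous_snd).mul contDiff_coneWeight.continuous
    · exact hasCompactSupport_coneTest hda0 hε
  have hmain : 0 ≤ ∫ p in halfPlane, (φ (W p) * fderiv ℝ θ p (0, 1) +
      entropyFlux G φ (W p) * fderiv ℝ θ p (1, 0)) := by
    refine (hw.dissipative φ hφ hc θ hθ).trans (le_of_eq ?_)
    refine setIntegral_congr_fun measurableSet_halfPlane fun p hp => ?_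
    simp only [← hW p.1 p.2 hp.2, Prod.mk.eta]
  -- The flux may be shifted by the constant `c` because the space derivative of a test function
  -- integrates to zero.
  have hsplit : ∫ p in halfPlane, (φ (W p) * fderiv ℝ θ p (0, 1) +
      entropyFlux G φ (W p) * fderiv ℝ θ p (1, 0)) =
      ∫ p in halfPlane, (φ (W p) * fderiv ℝ θ p (0, 1) +
      (entropyFlux G φ (W p) * fderiv ℝ θ p (1, 0) - c * fderiv ℝ θ p (1, 0))) := by
    have h1 := integral_sub (hφt.add hψx) hcx
    rw [integral_const_mul, hθ.integral_fderiv_space, mul_zero, sub_zero] at h1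
    rw [← Pi.add_def, ← h1]
    simp only [Pi.add_apply, add_sub_assoc]
  rw [hsplit] at hmain
  refine hmain.trans (integral_mono_ae (hφt.add (hψx.sub hcx)) hR ?_)
  filter_upwards [hQ] with p hp
  obtain ⟨x, t⟩ := p
  set b := deriv expNegInvGlue (x - r * t - A) * expNegInvGlue (B - (x - s * t)) with hb
  set d := expNegInvGlue (x - r * t - A) * deriv expNegInvGlue (B - (x - s * t)) with hd
  have hb0 : 0 ≤ b := mul_nonneg (deriv_expNegInvGlue_nonneg _) (expNegInvGlue.nonneg _)
  have hd0 : 0 ≤ d := mul_nonneg (expNegInvGlue.nonneg _) (deriv_expNegInvGlue_nonneg _)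
  have hx : fderiv ℝ θ (x, t) (1, 0) = a t * (b - d) :=
    fderiv_apply_space hθd ((hasDerivAt_coneWeight_space x t).const_mul (a t))
  have ht : fderiv ℝ θ (x, t) (0, 1) =
      deriv a t * coneWeight A B r s (x, t) + a t * (-r * b + s * d) :=
    fderiv_apply_time hθd (((ha.differentiable (by simp) t).hasDerivAt).mul
      (hasDerivAt_coneWeight_time x t))
  simp only [hx, ht]
  -- The end terms are `a b (ψ - c - r φ)` on the left and `-a d (ψ - c - s φ)` on the right. Both
  -- are nonpositive: relative to the moving ends, nothing flows in.
  have h1 := mul_le_mul_of_nonneg_left hp.2 (mul_nonneg (hnn t) hb0)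
  have h2 := mul_le_mul_of_nonneg_left hp.1 (mul_nonneg (hnn t) hd0)
  linarith

end Weighted

/-! ### Vanishing of an entropy on a moving interval -/

section Vanishing

variable {K : ℕ} {φ u₀ : ℝ → ℝ} {w : ℝ → ℝ → ℝ} {W : ℝ × ℝ → ℝ} {A B r s : ℝ}

/-- The cone-weighted integral of an entropy which vanishes initially on `(A, B)` is small for small
times. -/
lemma tendsto_integral_coneWeight
    (hWm : Measurable W) (hWb : ∀ p, W p ∈ Icc (0 : ℝ) K) (hW : ∀ x t, 0 < t → W (x, t) = w x t)
    (hu₀ : Measurable u₀) (hu₀b : ∀ x, u₀ x ∈ Icc (0 : ℝ) K) (hini : HasInitialDatum w u₀)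
    (hc : ContinuousOn φ (Icc (0 : ℝ) K)) (hφ0 : ∀ u ∈ Icc (0 : ℝ) K, 0 ≤ φ u)
    (hφL : ∀ u ∈ Icc (0 : ℝ) K, ∀ v ∈ Icc (0 : ℝ) K, |φ u - φ v| ≤ |u - v|)
    (hvan : ∀ x ∈ Ioo A B, φ (u₀ x) = 0) :
    Tendsto (fun t => ∫ x, φ (W (x, t)) * coneWeight A B r s (x, t)) (𝓝[>] 0) (𝓝 0) := by
  obtain ⟨M, hM⟩ := isCompact_Icc.exists_bound_of_continuousOn hc
  set R := |A| + |B| + (|r| + |s|) * 1 with hR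
  have hline : ∀ t : ℝ, Measurable fun x : ℝ => (x, t) := fun t => by fun_prop
  have hγc : ∀ t : ℝ, Continuous fun x => coneWeight A B r s (x, t) := fun t =>
    contDiff_coneWeight.continuous.comp (by fun_prop)
  have hmφ : ∀ t, Measurable fun x => φ (W (x, t)) := fun t =>
    measurable_comp_of_continuousOn (Nat.cast_nonneg K) hc (hWm.comp (hline t)) fun x => hWb _
  have hmφ0 : Measurable fun x => φ (u₀ x) :=
    measurable_comp_of_continuousOn (Nat.cast_nonneg K) hc hu₀ hu₀b
  have hγi : ∀ t, IntegrableOn (fun x => coneWeight A B r s (x, t)) (Icc (-R) R) := fun t =>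
    (hγc t).continuousOn.integrableOn_compact isCompact_Icc
  have h2 : Tendsto (fun t => ∫ x in Icc (-R) R, φ (u₀ x) * coneWeight A B r s (x, t)) (𝓝[>] 0)
      (𝓝 0) := by
    -- At time `0` one of the two factors vanishes: the entropy of the datum on `(A, B)`, the weight
    -- outside.
    have hzero : ∀ x, φ (u₀ x) * coneWeight A B r s (x, 0) = 0 := by
      intro x
      by_cases hx : x ∈ Ioo A B
      · rw [hvan x hx, zero_mul]
      · rw [coneWeight_eq_zero (by simpa using hx), mul_zero]
    have := tendsto_integral_filter_of_dominated_convergence (l := 𝓝[>] (0 : ℝ))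
      (μ := volume.restrict (Icc (-R) R))
      (F := fun t x => φ (u₀ x) * coneWeight A B r s (x, t))
      (f := fun x => φ (u₀ x) * coneWeight A B r s (x, 0)) (fun _ => M)
      (Eventually.of_forall fun t => (hmφ0.mul (hγc t).measurable).aestronglyMeasurable)
      (Eventually.of_forall fun t => Eventually.of_forall fun x => ?_)
      (integrable_const M) (Eventually.of_forall fun x => ?_)
    · simpa only [hzero, integral_zero] using this
    · rw [norm_mul]
      refine (mul_le_of_le_one_right (norm_nonneg _) ?_).trans (hM _ (hu₀b x))
      rw [Real.norm_of_nonneg (coneWeight_nonneg _)]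
      exact coneWeight_le_one _
    · have hct : Continuous fun t => coneWeight A B r s (x, t) :=
        contDiff_coneWeight.continuous.comp (by fun_prop)
      exact ((hct.tendsto 0).mono_left nhdsWithin_le_nhds).const_mul _
  have h3 := (hini (-R) R).add h2
  rw [add_zero] at h3
  -- The Lipschitz bound on `φ` and the bound `1` on the weight give `φ (W) γ ≤ |w - u₀| + φ (u₀)
  -- γ`, where `γ` is the cone weight; both terms have vanishing integral.
  refine squeeze_zero' ?_ ?_ h3
  · exact Eventually.of_forall fun t => integral_nonneg fun x =>
      mul_nonneg (hφ0 _ (hWb _)) (coneWeight_nonneg _)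
  · filter_upwards [Ioo_mem_nhdsGT (zero_lt_one' ℝ)] with t ht
    have hset : ∫ x, φ (W (x, t)) * coneWeight A B r s (x, t) =
        ∫ x in Icc (-R) R, φ (W (x, t)) * coneWeight A B r s (x, t) := by
      refine (setIntegral_eq_integral_of_forall_compl_eq_zero fun x hx => ?_).symm
      by_contra hne
      exact hx (abs_le.1 (abs_le_of_coneWeight_ne_zero (p := (x, t)) (right_ne_zero_of_mul hne)
        ht.1.le ht.2.le))
    have hi1 : IntegrableOn (fun x => |w x t - u₀ x|) (Icc (-R) R) := by
      have hm : Measurable fun x => |W (x, t) - u₀ x| :=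
        ((hWm.comp (hline t)).sub hu₀).abs
      have hK : IntegrableOn (fun _ : ℝ => (K : ℝ)) (Icc (-R) R) := integrable_const _
      refine (Integrable.mono' hK hm.aestronglyMeasurable (Eventually.of_forall fun x => ?_)).congr
        (Eventually.of_forall fun x => ?_)
      · rw [Real.norm_eq_abs, abs_abs]
        exact abs_le.2 ⟨by linarith [(hWb (x, t)).1, (hu₀b x).2],
          by linarith [(hWb (x, t)).2, (hu₀b x).1]⟩
      · simp only [hW x t ht.1]
    have hi2 : IntegrableOn (fun x => φ (u₀ x) * coneWeight A B r s (x, t)) (Icc (-R) R) :=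
      integrable_bounded_mul hmφ0.aestronglyMeasurable (fun x => hM _ (hu₀b x)) (hγi t)
    have hi3 : IntegrableOn (fun x => φ (W (x, t)) * coneWeight A B r s (x, t)) (Icc (-R) R) :=
      integrable_bounded_mul (hmφ t).aestronglyMeasurable (fun x => hM _ (hWb _)) (hγi t)
    rw [hset, ← integral_add hi1 hi2]
    refine integral_mono hi3 (hi1.add hi2) fun x => ?_
    have h4 := (le_abs_self _).trans (hφL _ (hWb (x, t)) _ (hu₀b x))
    rw [hW x t ht.1] at h4
    have h5 := mul_le_of_le_one_right (abs_nonneg (w x t - u₀ x))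
      (coneWeight_le_one (A := A) (B := B) (r := r) (s := s) (x, t))
    have h6 := mul_le_mul_of_nonneg_right h4
      (coneWeight_nonneg (A := A) (B := B) (r := r) (s := s) (x, t))
    simp only [hW x t ht.1]
    linarith

end Vanishing

section Vanishing

variable {K : ℕ} {G φ u₀ : ℝ → ℝ} {C : ℝ≥0} {w : ℝ → ℝ → ℝ} {W : ℝ × ℝ → ℝ} {A B r s c : ℝ}

lemma integrable_mul_coneTest
    (hWm : Measurable W) (hWb : ∀ p, W p ∈ Icc (0 : ℝ) K) (hc : ContinuousOn φ (Icc (0 : ℝ) K))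
    {a : ℝ → ℝ} {ε T : ℝ} (ha : Continuous a) (ha0 : ∀ t, a t ≠ 0 → t ∈ Icc ε T) (hε : 0 < ε) :
    Integrable fun p => φ (W p) * coneTest a A B r s p := by
  obtain ⟨M, hM⟩ := isCompact_Icc.exists_bound_of_continuousOn hc
  have hcont : Continuous (coneTest a A B r s) :=
    (ha.comp continuous_snd).mul contDiff_coneWeight.continuous
  exact integrable_bounded_mul
    (measurable_comp_of_continuousOn (Nat.cast_nonneg K) hc hWm hWb).aestronglyMeasurable
    (fun p => hM _ (hWb p))
    (hcont.integrable_of_hasCompactSupport (hasCompactSupport_coneTest ha0 hε))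

/-- If the weighted mass is at most `η` for times below `δ`, then it stays so in the weak sense. -/
lemma IsEntropySolution.integral_coneTest_le (hK : (0 : ℝ) < K)
    (hG : LipschitzOnWith C G (Icc (0 : ℝ) K)) (hw : IsEntropySolution K G w)
    (hWm : Measurable W) (hWb : ∀ p, W p ∈ Icc (0 : ℝ) K) (hW : ∀ x t, 0 < t → W (x, t) = w x t)
    (hφ : ConvexOn ℝ (Icc (0 : ℝ) K) φ) (hc : ContinuousOn φ (Icc (0 : ℝ) K))
    (hφ0 : ∀ u ∈ Icc (0 : ℝ) K, 0 ≤ φ u)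
    (hQ : ∀ᵐ p ∂((volume : Measure (ℝ × ℝ)).restrict halfPlane),
      s * φ (W p) ≤ entropyFlux G φ (W p) - c ∧ entropyFlux G φ (W p) - c ≤ r * φ (W p))
    {ε δ η T : ℝ} (hε : 0 < ε) (hεδ : 2 * ε < δ)
    (hsmall : ∀ t ∈ Ioo 0 δ, ∫ x, φ (W (x, t)) * coneWeight A B r s (x, t) ≤ η) :
    ∫ p in halfPlane, φ (W p) *
      coneTest (fun t => ramp ε t * deriv expNegInvGlue (T - t)) A B r s p ≤ η := by
  have hEc : Continuous expNegInvGlue := (expNegInvGlue.contDiff (n := 0)).continuous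
  have hE'c : Continuous (deriv expNegInvGlue) :=
    (expNegInvGlue.contDiff (n := 1)).continuous_deriv le_rfl
  have hrc : Continuous (ramp ε) := contDiff_ramp.continuous
  have hr'c : Continuous (deriv (ramp ε)) := contDiff_ramp.continuous_deriv (by simp)
  have hYi := integrable_mul_coneTest (A := A) (B := B) (r := r) (s := s) hWm hWb hc
    (a := fun t => ramp ε t * deriv expNegInvGlue (T - t)) (by fun_prop)
    (fun t => mem_Icc_of_ramp_mul_ne_zero hε fun _ => deriv_expNegInvGlue_eq_zero) hε
  have hXi := integrable_mul_coneTest (A := A) (B := B) (r := r) (s := s) hWm hWb hc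
    (a := fun t => deriv (ramp ε) t * expNegInvGlue (T - t)) (by fun_prop)
    (fun t ht => mem_Icc_of_deriv_ramp_ne_zero hε (left_ne_zero_of_mul ht)) hε
  have h1 := hw.integral_coneWeight_nonneg (A := A) (B := B) hK hG hWm hWb hW hφ hc hQ
    (contDiff_timeWeight ε T)
    (fun t => mem_Icc_of_ramp_mul_ne_zero hε fun _ hy => expNegInvGlue.zero_of_nonpos hy.le) hε
    (timeWeight_nonneg ε T)
  have h2 : ∫ p in halfPlane, φ (W p) * (deriv (timeWeight ε T) p.2 * coneWeight A B r s p) =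
      (∫ p in halfPlane, φ (W p) *
        coneTest (fun t => deriv (ramp ε) t * expNegInvGlue (T - t)) A B r s p) -
      ∫ p in halfPlane, φ (W p) *
        coneTest (fun t => ramp ε t * deriv expNegInvGlue (T - t)) A B r s p := by
    rw [← integral_sub hXi.restrict hYi.restrict]
    simp only [coneTest, deriv_timeWeight, sub_mul, mul_sub]
  refine le_trans (by linarith : _ ≤ ∫ p in halfPlane, φ (W p) *
        coneTest (fun t => deriv (ramp ε) t * expNegInvGlue (T - t)) A B r s p) ?_
  have hXi' := hXi.restrict (s := halfPlane)
  rw [volume_restrict_halfPlane] at hXi' ⊢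
  rw [integral_prod_symm _ hXi']
  -- The derivative of the ramp is a probability density carried by `[ε, 2 ε]`, inside the times
  -- where the weighted mass is at most `η`.
  calc _ ≤ ∫ t in Ioi (0 : ℝ), deriv (ramp ε) t * η := by
        refine setIntegral_mono_on hXi'.integral_prod_right ((integrableOn_deriv_ramp hε).mul_const η)
          measurableSet_Ioi fun t ht => ?_
        have hpull : ∫ x, φ (W (x, t)) *
            coneTest (fun t => deriv (ramp ε) t * expNegInvGlue (T - t)) A B r s (x, t) =
            deriv (ramp ε) t * (expNegInvGlue (T - t) *
              ∫ x, φ (W (x, t)) * coneWeight A B r s (x, t)) := by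
          rw [← integral_const_mul, ← integral_const_mul]
          refine integral_congr_ae (Eventually.of_forall fun x => ?_)
          simp only [coneTest]
          ring
        rw [hpull]
        have hr0 : 0 ≤ deriv (ramp ε) t := (ramp_monotone hε).deriv_nonneg
        by_cases hd : deriv (ramp ε) t = 0
        · simp [hd]
        · have hmem := mem_Icc_of_deriv_ramp_ne_zero hε hd
          refine mul_le_mul_of_nonneg_left ?_ hr0
          refine (mul_le_of_le_one_left (integral_nonneg fun x =>
            mul_nonneg (hφ0 _ (hWb _)) (coneWeight_nonneg _)) (expNegInvGlue_le_one _)).trans ?_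
          exact hsmall t ⟨ht, hmem.2.trans_lt hεδ⟩
    _ = η := by rw [integral_mul_const, integral_deriv_ramp hε, one_mul]

/-- An entropy which vanishes initially on `(A, B)` vanishes on the moving interval
`(A + r t, B + s t)`, provided that no entropy flows in through its ends. -/
theorem IsEntropySolution.ae_eq_zero_of_initial (hK : (0 : ℝ) < K)
    (hG : LipschitzOnWith C G (Icc (0 : ℝ) K)) (hw : IsEntropySolution K G w)
    (hWm : Measurable W) (hWb : ∀ p, W p ∈ Icc (0 : ℝ) K) (hW : ∀ x t, 0 < t → W (x, t) = w x t)
    (hφ : ConvexOn ℝ (Icc (0 : ℝ) K) φ) (hc : ContinuousOn φ (Icc (0 : ℝ) K))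
    (hφ0 : ∀ u ∈ Icc (0 : ℝ) K, 0 ≤ φ u)
    (hφL : ∀ u ∈ Icc (0 : ℝ) K, ∀ v ∈ Icc (0 : ℝ) K, |φ u - φ v| ≤ |u - v|)
    (hu₀ : Measurable u₀) (hu₀b : ∀ x, u₀ x ∈ Icc (0 : ℝ) K) (hini : HasInitialDatum w u₀)
    (hvan : ∀ x ∈ Ioo A B, φ (u₀ x) = 0)
    (hQ : ∀ᵐ p ∂((volume : Measure (ℝ × ℝ)).restrict halfPlane),
      s * φ (W p) ≤ entropyFlux G φ (W p) - c ∧ entropyFlux G φ (W p) - c ≤ r * φ (W p)) :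
    ∀ᵐ p ∂((volume : Measure (ℝ × ℝ)).restrict halfPlane),
      A + r * p.2 < p.1 → p.1 < B + s * p.2 → φ (W p) = 0 := by
  have hlim := tendsto_integral_coneWeight (r := r) (s := s) hWm hWb hW hu₀ hu₀b hini hc hφ0 hφL
    hvan
  have hE'c : Continuous (deriv expNegInvGlue) :=
    (expNegInvGlue.contDiff (n := 1)).continuous_deriv le_rfl
  have hslab : ∀ τ T : ℝ, 0 < τ → ∀ᵐ p : ℝ × ℝ, τ < p.2 → p.2 < T → A + r * p.2 < p.1 →
      p.1 < B + s * p.2 → φ (W p) = 0 := by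
    intro τ T hτ
    set D : Set (ℝ × ℝ) := {p | τ < p.2} with hD
    have hDm : MeasurableSet D := measurableSet_lt measurable_const measurable_snd
    have hDh : D ⊆ halfPlane := fun p hp => ⟨mem_univ _, hτ.trans hp⟩
    set Y : ℝ → ℝ × ℝ → ℝ := fun ε p => φ (W p) *
      coneTest (fun t => ramp ε t * deriv expNegInvGlue (T - t)) A B r s p with hY
    have hYi : ∀ ε, 0 < ε → Integrable (Y ε) := fun ε hε =>
      integrable_mul_coneTest hWm hWb hc
        (contDiff_ramp.continuous.mul (hE'c.comp (continuous_const.sub continuous_id)))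
        (fun t => mem_Icc_of_ramp_mul_ne_zero hε fun _ => deriv_expNegInvGlue_eq_zero) hε
    have hY0 : ∀ ε p, 0 ≤ Y ε p := fun ε p => mul_nonneg (hφ0 _ (hWb p))
      (mul_nonneg (mul_nonneg (Real.smoothTransition.nonneg _) (deriv_expNegInvGlue_nonneg _))
        (coneWeight_nonneg _))
    have hτ2 : 0 < τ / 2 := half_pos hτ
    have hzero : ∫ p in D, Y (τ / 2) p = 0 := by
      refine le_antisymm (le_of_forall_pos_le_add fun η hη => ?_)
        (integral_nonneg fun p => hY0 _ p)
      have hev := hlim.eventually_lt_const hη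
      obtain ⟨δ, hδ, hsub⟩ := mem_nhdsGT_iff_exists_Ioo_subset.1 hev
      have hδ0 : (0 : ℝ) < δ := hδ
      -- `ε ≤ τ / 2` makes both ramps equal to `1` for times beyond `τ`, so the integral is
      -- independent of `ε` there; `ε ≤ δ / 3` keeps the whole ramp below `δ`.
      set ε := min (τ / 2) (δ / 3) with hε
      have hε0 : 0 < ε := lt_min hτ2 (by linarith)
      have hετ : 2 * ε ≤ τ := by linarith [min_le_left (τ / 2) (δ / 3)]
      have hεδ : 2 * ε < δ := by linarith [min_le_right (τ / 2) (δ / 3)]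
      have hcongr : ∫ p in D, Y (τ / 2) p = ∫ p in D, Y ε p := by
        refine setIntegral_congr_fun hDm fun p hp => ?_
        have hp' : τ < p.2 := hp
        simp only [hY, coneTest, ramp_eq_one hτ2 (by linarith : 2 * (τ / 2) ≤ p.2),
          ramp_eq_one hε0 (hετ.trans hp'.le)]
      rw [hcongr, zero_add]
      refine (setIntegral_mono_set (hYi ε hε0).integrableOn (Eventually.of_forall fun p => hY0 ε p)
        (LE.le.eventuallyLE hDh)).trans ?_
      exact hw.integral_coneTest_le hK hG hWm hWb hW hφ hc hφ0 hQ hε0 hεδ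
        fun t ht => (hsub ht).le
    rw [setIntegral_eq_zero_iff_of_nonneg_ae (Eventually.of_forall fun p => hY0 _ p)
      (hYi _ hτ2).integrableOn, Filter.EventuallyEq, ae_restrict_iff' hDm] at hzero
    filter_upwards [hzero] with p hp hpτ hpT hpA hpB
    have h := hp hpτ
    simp only [hY, coneTest, ramp_eq_one hτ2 (by linarith : 2 * (τ / 2) ≤ p.2), one_mul,
      Pi.zero_apply] at h
    refine (mul_eq_zero.1 h).resolve_right (mul_pos ?_ (coneWeight_pos hpA hpB)).ne'
    exact deriv_expNegInvGlue_pos (by linarith)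
  -- Countably many time slabs exhaust the half-plane.
  have hall : ∀ᵐ p : ℝ × ℝ, ∀ n : ℕ, 1 / ((n : ℝ) + 1) < p.2 → p.2 < n → A + r * p.2 < p.1 →
      p.1 < B + s * p.2 → φ (W p) = 0 :=
    ae_all_iff.2 fun n => hslab _ _ (by positivity)
  rw [ae_restrict_iff' measurableSet_halfPlane]
  filter_upwards [hall] with p hp hpos h1 h2
  have hp0 : 0 < p.2 := hpos.2
  obtain ⟨n, hn⟩ := exists_nat_gt (max (1 / p.2) p.2)
  refine hp n ?_ ((le_max_right _ _).trans_lt hn) h1 h2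
  have h3 : 1 / p.2 < n := (le_max_left _ _).trans_lt hn
  rw [div_lt_iff₀ hp0] at h3
  rw [div_lt_iff₀ (by positivity)]
  nlinarith

end Vanishing

/-! ### Hinge entropies -/

section Hinge

variable {G φ : ℝ → ℝ} {C : ℝ≥0} {b α u : ℝ}

lemma integral_deriv_mul_deriv_of_eq (hG : LipschitzOnWith C G (Icc 0 b)) {x y d : ℝ}
    (hx : x ∈ Icc 0 b) (hy : y ∈ Icc 0 b) (hxy : x ≤ y) (hφ : ∀ w ∈ Ioo x y, deriv φ w = d) :
    IntervalIntegrable (fun w => deriv φ w * deriv G w) volume x y ∧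
      ∫ w in x..y, deriv φ w * deriv G w = d * (G y - G x) := by
  have hae : ∀ᵐ w, w ∈ uIoc x y → d * deriv G w = deriv φ w * deriv G w := by
    filter_upwards [compl_mem_ae_iff.2 (measure_singleton y)] with w hw hwm
    rw [uIoc_of_le hxy] at hwm
    rw [hφ w ⟨hwm.1, lt_of_le_of_ne hwm.2 hw⟩]
  have hi := (intervalIntegrable_deriv_of_lipschitzOnWith hG hx hy).const_mul d
  refine ⟨hi.congr_ae ?_, ?_⟩
  · exact (ae_restrict_iff' measurableSet_uIoc).2 hae
  · rw [← intervalIntegral.integral_congr_ae hae, intervalIntegral.integral_const_mul,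
      integral_deriv_of_lipschitzOnWith hG hx hy]

/-- The entropy `(u - α)⁺`. -/
def upperHinge (α u : ℝ) : ℝ := max (u - α) 0

/-- The entropy `(α - u)⁺`. -/
def lowerHinge (α u : ℝ) : ℝ := max (α - u) 0

lemma deriv_eq_of_eqOn {f g : ℝ → ℝ} {x y w d : ℝ} (hw : w ∈ Ioo x y) (h : EqOn f g (Ioo x y))
    (hg : HasDerivAt g d w) : deriv f w = d :=
  (hg.congr_of_eventuallyEq (h.eventuallyEq_of_mem (Ioo_mem_nhds hw.1 hw.2))).deriv

lemma entropyFlux_upperHinge (hG : LipschitzOnWith C G (Icc 0 b)) (hα : α ∈ Icc 0 b)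
    (hu : u ∈ Icc 0 b) : entropyFlux G (upperHinge α) u = G (max u α) - G α := by
  have h0 : (0 : ℝ) ∈ Icc 0 b := ⟨le_rfl, hα.1.trans hα.2⟩
  have hlow : ∀ y ≤ α, ∀ w ∈ Ioo 0 y, deriv (upperHinge α) w = 0 := fun y hy w hw =>
    deriv_eq_of_eqOn hw (fun z hz => max_eq_right (by linarith [hz.2])) (hasDerivAt_const w 0)
  have hhigh : ∀ w ∈ Ioo α u, deriv (upperHinge α) w = 1 := fun w hw =>
    deriv_eq_of_eqOn hw (fun z hz => max_eq_left (by linarith [hz.1]))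
      ((hasDerivAt_id w).sub_const α)
  rcases le_total u α with h | h
  · rw [entropyFlux, (integral_deriv_mul_deriv_of_eq hG h0 hu hu.1 (hlow u h)).2, max_eq_right h]
    ring
  · have h1 := integral_deriv_mul_deriv_of_eq hG h0 hα hα.1 (hlow α le_rfl)
    have h2 := integral_deriv_mul_deriv_of_eq hG hα hu h hhigh
    rw [entropyFlux, ← intervalIntegral.integral_add_adjacent_intervals h1.1 h2.1, h1.2, h2.2,
      max_eq_left h]
    ring

/-- `entropyFlux` is normalized to vanish at `0`, whereas the convenient flux vanishes at `α`; the
difference is the constant `c` of the localized inequality. -/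
lemma entropyFlux_lowerHinge (hG : LipschitzOnWith C G (Icc 0 b)) (hα : α ∈ Icc 0 b)
    (hu : u ∈ Icc 0 b) :
    entropyFlux G (lowerHinge α) u - (G 0 - G α) = G α - G (min u α) := by
  have h0 : (0 : ℝ) ∈ Icc 0 b := ⟨le_rfl, hα.1.trans hα.2⟩
  have hlow : ∀ y ≤ α, ∀ w ∈ Ioo 0 y, deriv (lowerHinge α) w = -1 := fun y hy w hw =>
    deriv_eq_of_eqOn hw (fun z hz => max_eq_left (by linarith [hz.2]))
      ((hasDerivAt_id w).const_sub α)
  have hhigh : ∀ w ∈ Ioo α u, deriv (lowerHinge α) w = 0 := fun w hw =>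
    deriv_eq_of_eqOn hw (fun z hz => max_eq_right (by linarith [hz.1])) (hasDerivAt_const w 0)
  rcases le_total u α with h | h
  · rw [entropyFlux, (integral_deriv_mul_deriv_of_eq hG h0 hu hu.1 (hlow u h)).2, min_eq_left h]
    ring
  · have h1 := integral_deriv_mul_deriv_of_eq hG h0 hα hα.1 (hlow α le_rfl)
    have h2 := integral_deriv_mul_deriv_of_eq hG hα hu h hhigh
    rw [entropyFlux, ← intervalIntegral.integral_add_adjacent_intervals h1.1 h2.1, h1.2, h2.2,
      min_eq_right h]
    ring

lemma upperHinge_eq (α u : ℝ) : upperHinge α u = max u α - α := by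
  rw [upperHinge, ← max_sub_sub_right, sub_self]

lemma lowerHinge_eq (α u : ℝ) : lowerHinge α u = α - min u α := by
  rw [lowerHinge, ← max_sub_sub_left, sub_self]

lemma convexOn_upperHinge (s : Set ℝ) (hs : Convex ℝ s) : ConvexOn ℝ s (upperHinge α) := by
  have h := (convexOn_affine s hs (-α) 1).sup (convexOn_affine s hs 0 0)
  refine h.congr fun u _ => ?_
  simp only [Pi.sup_apply, upperHinge]
  ring_nf

lemma convexOn_lowerHinge (s : Set ℝ) (hs : Convex ℝ s) : ConvexOn ℝ s (lowerHinge α) := by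
  have h := (convexOn_affine s hs α (-1)).sup (convexOn_affine s hs 0 0)
  refine h.congr fun u _ => ?_
  simp only [Pi.sup_apply, lowerHinge]
  ring_nf

lemma continuous_upperHinge : Continuous (upperHinge α) := by unfold upperHinge; fun_prop

lemma continuous_lowerHinge : Continuous (lowerHinge α) := by unfold lowerHinge; fun_prop

lemma abs_upperHinge_sub_le (u v : ℝ) : |upperHinge α u - upperHinge α v| ≤ |u - v| := by
  have h := abs_max_sub_max_le_abs (u - α) (v - α) 0
  rw [sub_sub_sub_cancel_right] at h
  exact h

lemma abs_lowerHinge_sub_le (u v : ℝ) : |lowerHinge α u - lowerHinge α v| ≤ |u - v| := by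
  have h := abs_max_sub_max_le_abs (α - u) (α - v) 0
  rw [sub_sub_sub_cancel_left, abs_sub_comm v u] at h
  exact h

/-- Finite speed of propagation: a window end moving inwards at speed `C` lets no hinge entropy in,
whatever the state. -/
lemma abs_flux_upperHinge_le (hG : LipschitzOnWith C G (Icc 0 b)) (hα : α ∈ Icc 0 b)
    (hu : u ∈ Icc 0 b) : |G (max u α) - G α| ≤ C * upperHinge α u := by
  have h := hG.dist_le_mul (max u α) ⟨hα.1.trans (le_max_right _ _), max_le hu.2 hα.2⟩ α hα
  rw [Real.dist_eq, Real.dist_eq, abs_of_nonneg (sub_nonneg.2 (le_max_right u α))] at h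
  rwa [upperHinge_eq]

lemma abs_flux_lowerHinge_le (hG : LipschitzOnWith C G (Icc 0 b)) (hα : α ∈ Icc 0 b)
    (hu : u ∈ Icc 0 b) : |G α - G (min u α)| ≤ C * lowerHinge α u := by
  have h := hG.dist_le_mul α hα (min u α) ⟨le_min hu.1 hα.1, (min_le_left _ _).trans hu.2⟩
  rw [Real.dist_eq, Real.dist_eq, abs_of_nonneg (sub_nonneg.2 (min_le_right u α))] at h
  rwa [lowerHinge_eq]

end Hinge

/-! ### Comparison with the Riemann fan -/

section Comparison

variable {K : ℕ} {G k u₀ : ℝ → ℝ} {C : ℝ≥0} {w : ℝ → ℝ → ℝ} {W : ℝ × ℝ → ℝ} {α : ℝ}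

lemma IsEntropySolution.ae_le_of_initial (hK : (0 : ℝ) < K)
    (hG : LipschitzOnWith C G (Icc (0 : ℝ) K)) (hw : IsEntropySolution K G w)
    (hWm : Measurable W) (hWb : ∀ p, W p ∈ Icc (0 : ℝ) K) (hW : ∀ x t, 0 < t → W (x, t) = w x t)
    (hu₀ : Measurable u₀) (hu₀b : ∀ x, u₀ x ∈ Icc (0 : ℝ) K) (hini : HasInitialDatum w u₀)
    {A B r s : ℝ} (hα : α ∈ Icc (0 : ℝ) K) (hvan : ∀ x ∈ Ioo A B, u₀ x ≤ α)
    (hQ : ∀ᵐ p ∂((volume : Measure (ℝ × ℝ)).restrict halfPlane),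
      s * upperHinge α (W p) ≤ G (max (W p) α) - G α ∧
        G (max (W p) α) - G α ≤ r * upperHinge α (W p)) :
    ∀ᵐ p ∂((volume : Measure (ℝ × ℝ)).restrict halfPlane),
      A + r * p.2 < p.1 → p.1 < B + s * p.2 → W p ≤ α := by
  have h := hw.ae_eq_zero_of_initial (φ := upperHinge α) (c := 0) (A := A) (B := B) (r := r) (s := s)
    hK hG hWm hWb hW (convexOn_upperHinge _ (convex_Icc _ _)) continuous_upperHinge.continuousOn
    (fun _ _ => le_max_right _ _) (fun _ _ _ _ => abs_upperHinge_sub_le _ _) hu₀ hu₀b hini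
    (fun x hx => max_eq_right (sub_nonpos.2 (hvan x hx))) ?_
  · filter_upwards [h] with p hp h1 h2
    exact sub_nonpos.1 (max_eq_right_iff.1 (hp h1 h2))
  · filter_upwards [hQ] with p hp
    rwa [entropyFlux_upperHinge hG hα (hWb p), sub_zero]

lemma IsEntropySolution.ae_ge_of_initial (hK : (0 : ℝ) < K)
    (hG : LipschitzOnWith C G (Icc (0 : ℝ) K)) (hw : IsEntropySolution K G w)
    (hWm : Measurable W) (hWb : ∀ p, W p ∈ Icc (0 : ℝ) K) (hW : ∀ x t, 0 < t → W (x, t) = w x t)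
    (hu₀ : Measurable u₀) (hu₀b : ∀ x, u₀ x ∈ Icc (0 : ℝ) K) (hini : HasInitialDatum w u₀)
    {A B r s : ℝ} (hα : α ∈ Icc (0 : ℝ) K) (hvan : ∀ x ∈ Ioo A B, α ≤ u₀ x)
    (hQ : ∀ᵐ p ∂((volume : Measure (ℝ × ℝ)).restrict halfPlane),
      s * lowerHinge α (W p) ≤ G α - G (min (W p) α) ∧
        G α - G (min (W p) α) ≤ r * lowerHinge α (W p)) :
    ∀ᵐ p ∂((volume : Measure (ℝ × ℝ)).restrict halfPlane),
      A + r * p.2 < p.1 → p.1 < B + s * p.2 → α ≤ W p := by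
  have h := hw.ae_eq_zero_of_initial (φ := lowerHinge α) (c := G 0 - G α) (A := A) (B := B) (r := r)
    (s := s) hK hG hWm hWb hW (convexOn_lowerHinge _ (convex_Icc _ _))
    continuous_lowerHinge.continuousOn
    (fun _ _ => le_max_right _ _) (fun _ _ _ _ => abs_lowerHinge_sub_le _ _) hu₀ hu₀b hini
    (fun x hx => max_eq_right (sub_nonpos.2 (hvan x hx))) ?_
  · filter_upwards [h] with p hp h1 h2
    exact sub_nonpos.1 (max_eq_right_iff.1 (hp h1 h2))
  · filter_upwards [hQ] with p hp
    rwa [entropyFlux_lowerHinge hG hα (hWb p)]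

lemma ae_of_forall_nat_window {P : ℝ × ℝ → Prop} {L R : ℕ → ℝ × ℝ → ℝ}
    (h : ∀ n, ∀ᵐ p ∂((volume : Measure (ℝ × ℝ)).restrict halfPlane),
      L n p < p.1 → p.1 < R n p → P p) :
    ∀ᵐ p ∂((volume : Measure (ℝ × ℝ)).restrict halfPlane),
      (∃ n, L n p < p.1 ∧ p.1 < R n p) → P p := by
  filter_upwards [ae_all_iff.2 h] with p hp ⟨n, h1, h2⟩ using hp n h1 h2

variable {lam rho : ℝ}

lemma measurable_riemannDatum : Measurable (riemannDatum lam rho) :=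
  Measurable.ite measurableSet_Iio measurable_const measurable_const

lemma riemannDatum_mem (hlt : lam < rho) (x : ℝ) : riemannDatum lam rho x ∈ Icc lam rho := by
  unfold riemannDatum
  split_ifs
  exacts [⟨le_rfl, hlt.le⟩, ⟨hlt.le, le_rfl⟩]

/-- A solution of the Riemann problem takes its values between the two states. -/
lemma IsRiemannSolution.ae_mem_Icc (hK : (0 : ℝ) < K)
    (hG : LipschitzOnWith C G (Icc (0 : ℝ) K)) (hlam : 0 ≤ lam) (hlt : lam < rho) (hrho : rho ≤ K)
    (hw : IsRiemannSolution K G lam rho w)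
    (hWm : Measurable W) (hWb : ∀ p, W p ∈ Icc (0 : ℝ) K)
    (hW : ∀ x t, 0 < t → W (x, t) = w x t) :
    ∀ᵐ p ∂((volume : Measure (ℝ × ℝ)).restrict halfPlane), W p ∈ Icc lam rho := by
  have hdat : ∀ x, riemannDatum lam rho x ∈ Icc (0 : ℝ) K := fun x =>
    Icc_subset_Icc hlam hrho (riemannDatum_mem hlt x)
  have hl : lam ∈ Icc (0 : ℝ) K := ⟨hlam, hlt.le.trans hrho⟩
  have hr : rho ∈ Icc (0 : ℝ) K := ⟨hlam.trans hlt.le, hrho⟩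
  have h1 := ae_of_forall_nat_window fun n : ℕ =>
    hw.1.ae_le_of_initial (A := -n) (B := n) (r := C) (s := -C) hK hG hWm hWb hW
      measurable_riemannDatum hdat hw.2 hr (fun x _ => (riemannDatum_mem hlt x).2)
      (Eventually.of_forall fun p => by
        have := abs_le.1 (abs_flux_upperHinge_le hG hr (hWb p))
        exact ⟨by linarith [this.1], this.2⟩)
  have h2 := ae_of_forall_nat_window fun n : ℕ =>
    hw.1.ae_ge_of_initial (A := -n) (B := n) (r := C) (s := -C) hK hG hWm hWb hW
      measurable_riemannDatum hdat hw.2 hl (fun x _ => (riemannDatum_mem hlt x).1)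
      (Eventually.of_forall fun p => by
        have := abs_le.1 (abs_flux_lowerHinge_le hG hl (hWb p))
        exact ⟨by linarith [this.1], this.2⟩)
  filter_upwards [h1, h2] with p hp1 hp2
  -- The windows `(-n + C t, n - C t)` shrink at speed `C` but contain any given point once `n` is
  -- large.
  obtain ⟨n, hn⟩ := exists_nat_gt (|p.1| + C * p.2)
  have := neg_abs_le p.1
  have := le_abs_self p.1
  have hwin : -(n : ℝ) + C * p.2 < p.1 ∧ p.1 < n + -C * p.2 := ⟨by linarith, by linarith⟩
  exact ⟨hp2 ⟨n, hwin⟩, hp1 ⟨n, hwin⟩⟩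

/-- A solution of the Riemann problem is at most `k v` to the left of the ray `x = v t` and at least
`k v` to the right of it. -/
lemma IsRiemannSolution.ae_compare (hK : (0 : ℝ) < K)
    (hG : LipschitzOnWith C G (Icc (0 : ℝ) K)) (hlam : 0 ≤ lam) (hlt : lam < rho) (hrho : rho ≤ K)
    (hk : IsArgmin G lam rho k) (hw : IsRiemannSolution K G lam rho w)
    (hWm : Measurable W) (hWb : ∀ p, W p ∈ Icc (0 : ℝ) K)
    (hW : ∀ x t, 0 < t → W (x, t) = w x t) (v : ℝ) :
    ∀ᵐ p ∂((volume : Measure (ℝ × ℝ)).restrict halfPlane),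
      (p.1 < v * p.2 → W p ≤ k v) ∧ (v * p.2 < p.1 → k v ≤ W p) := by
  have hdat : ∀ x, riemannDatum lam rho x ∈ Icc (0 : ℝ) K := fun x =>
    Icc_subset_Icc hlam hrho (riemannDatum_mem hlt x)
  have hα : k v ∈ Icc (0 : ℝ) K := Icc_subset_Icc hlam hrho (hk.mem v)
  have hmem := hw.ae_mem_Icc hK hG hlam hlt hrho hWm hWb hW
  have h1 := ae_of_forall_nat_window fun n : ℕ =>
    hw.1.ae_le_of_initial (A := -n) (B := 0) (r := C) (s := v) hK hG hWm hWb hW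
      measurable_riemannDatum hdat hw.2 hα
      (fun x hx => by rw [riemannDatum, if_pos hx.2]; exact (hk.mem v).1) (by
        filter_upwards [hmem] with p hp
        refine ⟨?_, (abs_le.1 (abs_flux_upperHinge_le hG hα (hWb p))).2⟩
        -- Minimality of `k v` against `max (W p) (k v)` says that the flux is at least `v` times
        -- the density, so the end `x = v t` lets nothing in. The bound `W p ∈ [lam, rho]` is needed
        -- for the competitor to be admissible.
        have := hk.le v (max (W p) (k v)) ⟨hp.1.trans (le_max_left _ _), max_le hp.2 (hk.mem v).2⟩
        rw [upperHinge_eq]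
        linarith)
  have h2 := ae_of_forall_nat_window fun n : ℕ =>
    hw.1.ae_ge_of_initial (A := 0) (B := n) (r := v) (s := -C) hK hG hWm hWb hW
      measurable_riemannDatum hdat hw.2 hα
      (fun x hx => by rw [riemannDatum, if_neg (not_lt.2 hx.1.le)]; exact (hk.mem v).2) (by
        filter_upwards [hmem] with p hp
        refine ⟨by linarith [(abs_le.1 (abs_flux_lowerHinge_le hG hα (hWb p))).1], ?_⟩
        have := hk.le v (min (W p) (k v)) ⟨le_min hp.1 (hk.mem v).1, (min_le_left _ _).trans hp.2⟩
        rw [lowerHinge_eq]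
        linarith)
  filter_upwards [h1, h2] with p hp1 hp2
  obtain ⟨n, hn⟩ := exists_nat_gt (|p.1| + C * p.2)
  have := neg_abs_le p.1
  have := le_abs_self p.1
  exact ⟨fun h => hp1 ⟨n, by linarith, by linarith⟩, fun h => hp2 ⟨n, by linarith, by linarith⟩⟩

/-- At each positive time, the exceptional rays meet the line in a countable set. -/
lemma ae_div_notMem_of_countable {S : Set ℝ} (hS : S.Countable) :
    ∀ᵐ p ∂((volume : Measure (ℝ × ℝ)).restrict halfPlane), p.1 / p.2 ∉ S := by
  rw [volume_restrict_halfPlane]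
  have hm : MeasurableSet {p : ℝ × ℝ | p.1 / p.2 ∈ S} :=
    (measurable_fst.div measurable_snd) hS.measurableSet
  rw [ae_iff]
  simp only [not_not]
  rw [Measure.prod_apply_symm hm, lintegral_eq_zero_iff' (by
    exact (measurable_measure_prodMk_right hm).aemeasurable)]
  filter_upwards [ae_restrict_mem measurableSet_Ioi] with t ht
  refine Countable.measure_zero ((hS.image fun v => v * t).mono fun x hx => ?_) _
  have hx' : x / t ∈ S := hx
  exact ⟨x / t, hx', div_mul_cancel₀ x (ne_of_gt ht)⟩

/-- Uniqueness: a solution of the Riemann problem is the fan `k (x / t)`. -/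
theorem IsRiemannSolution.ae_eq (hK : (0 : ℝ) < K)
    (hG : LipschitzOnWith C G (Icc (0 : ℝ) K)) (hlam : 0 ≤ lam) (hlt : lam < rho) (hrho : rho ≤ K)
    (hk : IsArgmin G lam rho k) (hw : IsRiemannSolution K G lam rho w) :
    ∀ᵐ p ∂((volume : Measure (ℝ × ℝ)).restrict halfPlane), w p.1 p.2 = k (p.1 / p.2) := by
  obtain ⟨W, hWm, hWb, hW⟩ := hw.1.exists_measurable
  have h := ae_all_iff.2 fun q : ℚ => hw.ae_compare hK hG hlam hlt hrho hk hWm hWb hW q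
  filter_upwards [h, ae_div_notMem_of_countable hk.monotone.countable_not_continuousAt,
    ae_restrict_mem measurableSet_halfPlane] with p hp hcont hpos
  have ht : 0 < p.2 := hpos.2
  have hcont : ContinuousAt k (p.1 / p.2) := not_not.1 hcont
  rw [← hW p.1 p.2 ht, Prod.mk.eta]
  refine le_antisymm (le_of_not_gt fun hlt' => ?_) (le_of_not_gt fun hlt' => ?_)
  -- If `k (x / t)` were below the solution, continuity would give a rational `q > x / t` with `k q`
  -- still below it, while the point lies left of the ray of speed `q`.
  · have hev := (hcont.eventually_lt_const hlt').filter_mono (nhdsWithin_le_nhds (s := Ioi (p.1 / p.2)))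
    obtain ⟨y, hy, hsub⟩ := mem_nhdsGT_iff_exists_Ioo_subset.1 hev
    obtain ⟨q, hq1, hq2⟩ := exists_rat_btwn (mem_Ioi.1 hy)
    exact absurd ((hp q).1 ((div_lt_iff₀ ht).1 hq1)) (not_le.2 (hsub ⟨hq1, hq2⟩))
  · have hev := (hcont.eventually_const_lt hlt').filter_mono (nhdsWithin_le_nhds (s := Iio (p.1 / p.2)))
    obtain ⟨y, hy, hsub⟩ := mem_nhdsLT_iff_exists_Ioo_subset.1 hev
    obtain ⟨q, hq1, hq2⟩ := exists_rat_btwn (mem_Iio.1 hy)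
    exact absurd ((hp q).2 ((lt_div_iff₀ ht).1 hq2)) (not_le.2 (hsub ⟨hq1, hq2⟩))

end Comparison

/-- A fan `h (x / t)` which is constant for large speeds attains the Riemann datum. -/
lemma hasInitialDatum_fan {h : ℝ → ℝ} {lam rho v₀ v₁ : ℝ} (hlt : lam < rho) (hm : Measurable h)
    (hmem : ∀ v, h v ∈ Icc lam rho) (hbelow : ∀ v, v < v₀ → h v = lam)
    (habove : ∀ v, v₁ < v → h v = rho) :
    HasInitialDatum (fun x t => h (x / t)) (riemannDatum lam rho) := by
  intro a b
  have := tendsto_integral_filter_of_dominated_convergence (l := 𝓝[>] (0 : ℝ))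
    (μ := volume.restrict (Icc a b))
    (F := fun t x => |h (x / t) - riemannDatum lam rho x|) (f := fun _ => 0)
    (fun _ => rho - lam)
    (Eventually.of_forall fun t => ((hm.comp (measurable_id.div_const t)).sub
      measurable_riemannDatum).abs.aestronglyMeasurable)
    (Eventually.of_forall fun t => Eventually.of_forall fun x => ?_)
    (integrable_const _) ?_
  · simpa using this
  · rw [Real.norm_eq_abs, abs_abs]
    have h1 := hmem (x / t)
    have h2 := riemannDatum_mem hlt x
    exact abs_le.2 ⟨by linarith [h1.1, h2.2], by linarith [h1.2, h2.1]⟩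
  -- For `x ≠ 0` the speed `x / t` tends to `±∞`, so the fan equals the datum for all small `t`.
  · filter_upwards [ae_restrict_of_ae (compl_mem_ae_iff.2 (measure_singleton (0 : ℝ)))] with x hx
    refine tendsto_const_nhds.congr' ?_
    rcases lt_or_gt_of_ne (show x ≠ 0 from hx) with hneg | hpos
    · have hlim : Tendsto (fun t : ℝ => x / t) (𝓝[>] 0) atBot :=
        tendsto_inv_nhdsGT_zero.const_mul_atTop_of_neg hneg
      filter_upwards [hlim.eventually_lt_atBot v₀] with t ht
      rw [hbelow _ ht, riemannDatum, if_pos hneg, sub_self, abs_zero]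
    · have hlim : Tendsto (fun t : ℝ => x / t) (𝓝[>] 0) atTop :=
        tendsto_inv_nhdsGT_zero.const_mul_atTop hpos
      filter_upwards [hlim.eventually_gt_atTop v₁] with t ht
      rw [habove _ ht, riemannDatum, if_neg (not_lt.2 hpos.le), sub_self, abs_zero]

/-- A fan which agrees with a selection of minimizers up to countably many speeds is an entropy
solution. -/
lemma IsArgmin.isEntropySolution_fan {K : ℕ} {G k h : ℝ → ℝ} {lam rho : ℝ} {C : ℝ≥0} {S : Set ℝ}
    (hk : IsArgmin G lam rho k) (hK : (0 : ℝ) < K) (hG : LipschitzOnWith C G (Icc (0 : ℝ) K))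
    (hlam : 0 ≤ lam) (hrho : rho ≤ K) (hmem : ∀ v, h v ∈ Icc lam rho) (hS : S.Countable)
    (hkh : ∀ v, v ∉ S → k v = h v) : IsEntropySolution K G (fun x t => h (x / t)) where
  measurable := by
    have hm : Measurable h := hk.monotone.measurable.measurable_of_countable_ne
      (hS.mono fun v hv => by_contra fun hvS => hv (hkh v hvS))
    exact hm.comp (measurable_fst.div (measurable_subtype_coe.comp measurable_snd))
  mem_Icc x t _ := Icc_subset_Icc hlam hrho (hmem _)
  dissipative φ hφ hc θ hθ := by
    refine (hk.dissipative hK hG hφ hc hlam hrho hθ).trans (le_of_eq (integral_congr_ae ?_))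
    filter_upwards [ae_div_notMem_of_countable hS] with p hp
    rw [hkh _ hp]

end ScalarLaw

end

/-! ### Assembly of the proposition. -/

theorem proposition4p1
    (K : ℕ) (R : Set ℝ) (hR_closed : IsClosed R) (hR_sub : R ⊆ Icc (0 : ℝ) K)
    (hR_zero : (0 : ℝ) ∈ R) (hR_K : (K : ℝ) ∈ R)
    (G : ℝ → ℝ) (hG_lip : ∃ C : ℝ≥0, LipschitzOnWith C G (Icc (0 : ℝ) K))
    (hG_lin : ScalarLaw.LinearOffSet R G)
    (lam rho : ℝ) (hlam : lam ∈ R) (hrho : rho ∈ R) (hlt : lam < rho) :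
    -- functions `H_c` and `h_c` as in the definitions exist
    (∃ H h : ℝ → ℝ, ScalarLaw.IsEnvelopeSlope G lam rho H ∧
      ScalarLaw.IsSlopeInverse G lam rho H h) ∧
    -- and for every choice of them:
    ∀ H h : ℝ → ℝ, ScalarLaw.IsEnvelopeSlope G lam rho H →
      ScalarLaw.IsSlopeInverse G lam rho H h →
      -- (i) `h v` is the unique minimizer of `G - v·` over `[lam, rho]`
      (∀ v : ℝ, v ∉ ScalarLaw.sigmaLow G lam rho →
        h v ∈ Icc lam rho ∧
          ∀ α ∈ Icc lam rho, α ≠ h v → G (h v) - v * h v < G α - v * α) ∧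
      -- `h (x / t)` is the entropy solution of the Riemann problem, unique up to null sets
      ScalarLaw.IsRiemannSolution K G lam rho (fun x t => h (x / t)) ∧
      (∀ w : ℝ → ℝ → ℝ, ScalarLaw.IsRiemannSolution K G lam rho w →
        ∀ᵐ p ∂((volume : Measure (ℝ × ℝ)).restrict ScalarLaw.halfPlane),
          w p.1 p.2 = h (p.1 / p.2)) ∧
      -- (ii) the minimum over `[lam, rho] ∩ R` is the minimum over `[lam, rho]`
      (∀ v : ℝ, v ∉ ScalarLaw.sigmaLow G lam rho → ∃ m : ℝ,
        IsLeast ((fun α => G α - v * α) '' Icc lam rho) m ∧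
          IsLeast ((fun α => G α - v * α) '' (Icc lam rho ∩ R)) m) ∧
      -- the entropy solution of the Riemann problem is `R`-valued almost everywhere
      (∀ w : ℝ → ℝ → ℝ, ScalarLaw.IsRiemannSolution K G lam rho w →
        ∀ᵐ p ∂((volume : Measure (ℝ × ℝ)).restrict ScalarLaw.halfPlane), w p.1 p.2 ∈ R) := by
  obtain ⟨C, hG⟩ := hG_lip
  have hl0 : 0 ≤ lam := (hR_sub hlam).1
  have hrK : rho ≤ K := (hR_sub hrho).2
  have hK : (0 : ℝ) < K := (hl0.trans_lt hlt).trans_le hrK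
  have hC : LipschitzOnWith C G (Icc lam rho) := hG.mono (Icc_subset_Icc hl0 hrK)
  refine ⟨?_, fun H h hH hh => ?_⟩
  · obtain ⟨H, hH⟩ := ScalarLaw.exists_isEnvelopeSlope hlt hC
    obtain ⟨h, hh⟩ := ScalarLaw.exists_isSlopeInverse hlt hH (hH.vMin_le_vMax hlt hC)
    exact ⟨H, h, hH, hh⟩
  have hmem := hh.mem_Icc_all hlt
  have hmin : ∀ v : ℝ, v ∉ ScalarLaw.sigmaLow G lam rho →
      ∀ α ∈ Icc lam rho, α ≠ h v → G (h v) - v * h v < G α - v * α := fun v hv α hα hne =>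
    hh.lt_of_notMem_sigmaLow hlt hC hH hv hα hne
  have hR : ∀ v : ℝ, v ∉ ScalarLaw.sigmaLow G lam rho → h v ∈ R := fun v hv =>
    ScalarLaw.mem_of_unique_minimizer hR_closed hG_lin hlam hrho (hmem v) (hmin v hv)
  -- An arbitrary selection of minimizers suffices: it is monotone, and it differs from `h` only on
  -- the countable set `sigmaLow`, which also makes `h` measurable.
  choose k hkmem hkmin using ScalarLaw.exists_minimizer hlt hC
  have hk : ScalarLaw.IsArgmin G lam rho k := ⟨hkmem, hkmin⟩
  have hkh : ∀ v : ℝ, v ∉ ScalarLaw.sigmaLow G lam rho → k v = h v := fun v hv => by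
    by_contra hne
    exact absurd (hkmin v (h v) (hmem v)) (not_le.2 (hmin v hv (k v) (hkmem v) hne))
  have hcount := ScalarLaw.countable_sigmaLow (G := G) (lam := lam) (rho := rho)
  have hm : Measurable h := hk.monotone.measurable.measurable_of_countable_ne
    (hcount.mono fun v hv => by_contra fun hvS => hv (hkh v hvS))
  refine ⟨fun v hv => ⟨hmem v, hmin v hv⟩, ⟨?_, ?_⟩, fun w hw => ?_, fun v hv => ?_, fun w hw => ?_⟩
  · exact hk.isEntropySolution_fan hK hG hl0 hrK hmem hcount hkh
  · exact ScalarLaw.hasInitialDatum_fan hlt hm hmem hh.below hh.above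
  · filter_upwards [hw.ae_eq hK hG hl0 hlt hrK hk, ScalarLaw.ae_div_notMem_of_countable hcount]
      with p hp hpS
    rw [hp, hkh _ hpS]
  · have hle : ∀ α ∈ Icc lam rho, G (h v) - v * h v ≤ G α - v * α := fun α hα => by
      rcases eq_or_ne α (h v) with rfl | hne
      exacts [le_rfl, (hmin v hv α hα hne).le]
    refine ⟨G (h v) - v * h v, ⟨⟨h v, hmem v, rfl⟩, ?_⟩, ⟨⟨h v, ⟨hmem v, hR v hv⟩, rfl⟩, ?_⟩⟩
    · rintro _ ⟨α, hα, rfl⟩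
      exact hle α hα
    · rintro _ ⟨α, hα, rfl⟩
      exact hle α hα.1
  · filter_upwards [hw.ae_eq hK hG hl0 hlt hrK hk, ScalarLaw.ae_div_notMem_of_countable hcount]
      with p hp hpS
    rw [hp, hkh _ hpS]
    exact hR _ hpS
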